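/- **Setting.** Let $2\le r\le 9$, $n\ge 0$ and $\varepsilon>0$. On a uniform mesh with cells $I_j=[x_{j-1/2},x_{j+1/2}]$ of width $\Delta x$ and centres $x_j$, let $\bar u_j=\frac1{\Delta x}\int_{I_j}u$ be the cell averages of a function $u$. For $s=0,\dots,r-1$ let $p_s$ be the polynomial of degree at most $r-1$ whose averages over the $r$ cells $I_{j+s-r+1},\dots,I_{j+s}$ are the $\bar u$'s, let $u^{s,-}_{j+1/2}=p_s(x_{j+1/2})$, and put $$\beta_s=\sum_{l=1}^{r-1}\Delta x^{2l-1}\int_{I_j}\big(p_s^{(l)}(x)\big)^2dx,\qquad d_s=\binom rs\binom{r-1}s\Big/\binom{2r-1}{r-1},\qquad \alpha_s^{\mathrm{M}(0)}=\frac{d_s}{(\varepsilon+\beta_s)^2},$$ where $\beta_s$ are the Jiang–Shu smoothness indicators and $d_s$ the optimal weights. For $m\ge0$ set $\omega_s^{\mathrm{M}(m)}=\alpha_s^{\mathrm{M}(m)}/\sum_{l=0}^{r-1}\alpha_l^{\mathrm{M}(m)}$, and for $m\ge 1$ set $$\alpha_s^{\mathrm{M}(m)}=g_s\big(\omega_s^{\mathrm{M}(m-1)}\big),\qquad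 g_s(\omega)=\frac{\omega\,(d_s+d_s^2-3d_s\omega+\omega^2)}{d_s^2+(1-2d_s)\omega}.$$ The $(2r-1)$th-order WENO-M scheme with $n$ mappings uses $u^-_{j+1/2}=\sum_s\omega_s^{\mathrm{M}(n)}u^{s,-}_{j+1/2}$, the mirror-image reconstruction $u^+_{j+1/2}$, the flux $\hat f_{j+1/2}=\frac12\big[f(u^-_{j+1/2})+f(u^+_{j+1/2})-a\,(u^+_{j+1/2}-u^-_{j+1/2})\big]$ with a constant $a$, and the semi-discrete operator $\mathcal L_j=-\frac1{\Delta x}(\hat f_{j+1/2}-\hat f_{j-1/2})$ for $u_t+f(u)_x=0$. **Statement.** Let $0\le n_{\mathrm{cp}}\le r-1$, and let $u$ be smooth near a point $x_c$ with $u'(x_c)=\dots=u^{(n_{\mathrm{cp}})}(x_c)=0$ and $u^{(n_{\mathrm{cp}}+1)}(x_c)\ne0$ (so $u'(x_c)\neq 0$ if $n_{\mathrm{cp}}=0$). Let $K$ be a constant. As $\Delta x\to0$, for all cells $I_j$ with $|x_j-x_c|\le K\Delta x$ (in particular, with $K=\frac12$, for the cells containing $x_c$), uniformly in the position of the mesh,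 in $j$ and in $\varepsilon>0$: 1. for $s=0,\dots,r-1$, $$\omega_s^{\mathrm{M}(n)}-d_s=O\big(\Delta x^{\,3^n(r-1-n_{\mathrm{cp}})}\big);$$ 2. the scheme has rate of convergence $r_{\mathrm c}$ (in the sense of order of accuracy): for every flux $f$ smooth near $u(x_c)$ and every constant $a$, $$\mathcal L_j+\frac{f(u(x_{j+1/2}))-f(u(x_{j-1/2}))}{\Delta x}=O(\Delta x^{\,r_{\mathrm c}}),\qquad r_{\mathrm c}=\begin{cases}2r-1,& n_{\mathrm{cp}}\le\big\lfloor\frac{3^n-1}{3^n}r-1\big\rfloor,\\ (3^n+1)(r-1)-3^n n_{\mathrm{cp}},&\text{otherwise.}\end{cases}$$ -/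

import Mathlib

open Polynomial
open scoped ContDiff

noncomputable section

namespace WENO

/-- Cell average `(1/Δx) ∫ u` over the cell with centre `x` and width `h`. -/
def cellAverage (u : ℝ → ℝ) (h x : ℝ) : ℝ :=
  (1 / h) * ∫ ξ in (x - h / 2)..(x + h / 2), u ξ

/-- Exact cell averages on the uniform mesh with centres `x_j = x₀ + j h`. -/
def meshAverages (u : ℝ → ℝ) (h x₀ : ℝ) (j : ℤ) : ℝ :=
  cellAverage u h (x₀ + j * h)

/-- Values at the cell interfaces of a primitive of the piecewise constant data on the substencil
`{s - r + 1, …, s}`; here `v k` is the average on the `k`-th cell to the right of the current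
cell. -/
def primitiveValue (r s : ℕ) (v : ℤ → ℝ) (i : ℕ) : ℝ :=
  ∑ k ∈ Finset.range i, v ((s : ℤ) - (r : ℤ) + 1 + (k : ℤ))

/-- The reconstruction polynomial of degree at most `r - 1` having the averages `v k` on the `r`
cells `k = s - r + 1, …, s`, in the variable `y = (x - x_j) / Δx` (so that cell `k` is
`[k - 1/2, k + 1/2]`): the derivative of the polynomial that interpolates the primitive at the
`r + 1` interfaces of the substencil. -/
def reconPoly (r s : ℕ) (v : ℤ → ℝ) : ℝ[X] :=
  derivative (Lagrange.interpolate (Finset.range (r + 1))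
    (fun i : ℕ => (s : ℝ) - (r : ℝ) + 1 / 2 + (i : ℝ)) (primitiveValue r s v))

/-- The substencil approximation `u^{s,-}_{j+1/2}`. -/
def subRecon (r s : ℕ) (v : ℤ → ℝ) : ℝ :=
  (reconPoly r s v).eval (1 / 2)

/-- The Jiang–Shu smoothness indicator
`β_s = ∑_{l=1}^{r-1} Δx^{2l-1} ∫_{I_j} (d^l p_s / dx^l)² dx`, written in `y = (x - x_j) / Δx`,
where the powers of `Δx` cancel. -/
def smoothness (r s : ℕ) (v : ℤ → ℝ) : ℝ :=
  ∑ l ∈ Finset.Icc 1 (r - 1),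
    ∫ y in (-(1 / 2) : ℝ)..(1 / 2), ((derivative^[l] (reconPoly r s v)).eval y) ^ 2

/-- The optimal (linear) weights `d_s` of the `(2r-1)`th-order scheme; for `r = 3` they are
`1/10, 6/10, 3/10`. -/
def optWeight (r s : ℕ) : ℝ :=
  ((r.choose s : ℝ) * ((r - 1).choose s : ℝ)) / ((2 * r - 1).choose (r - 1) : ℝ)

/-- Unnormalized WENO-JS weight `α_s = d_s / (ε + β_s)²`. -/
def alphaJS (r : ℕ) (ε : ℝ) (v : ℤ → ℝ) (s : ℕ) : ℝ :=
  optWeight r s / (ε + smoothness r s v) ^ 2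

/-- WENO-JS weight. -/
def weightJS (r : ℕ) (ε : ℝ) (v : ℤ → ℝ) (s : ℕ) : ℝ :=
  alphaJS r ε v s / ∑ l ∈ Finset.range r, alphaJS r ε v l

/-- The WENO-M mapping function with parameter `d`. -/
def mapM (d w : ℝ) : ℝ :=
  w * (d + d ^ 2 - 3 * d * w + w ^ 2) / (d ^ 2 + (1 - 2 * d) * w)

/-- One mapping step: apply `(g^M)_s` to each weight and normalize. -/
def mapStep (r : ℕ) (w : ℕ → ℝ) (s : ℕ) : ℝ :=
  mapM (optWeight r s) (w s) / ∑ l ∈ Finset.range r, mapM (optWeight r l) (w l)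

/-- The WENO-M weights with `n` times mapping; `n = 0` gives the WENO-JS weights. -/
def weightM (r : ℕ) (ε : ℝ) (v : ℤ → ℝ) : ℕ → ℕ → ℝ
  | 0 => weightJS r ε v
  | n + 1 => mapStep r (weightM r ε v n)

/-- The weights `ω_s^{M(n)}` used in `u^-_{j+1/2}`, for the mesh function `ubar`. -/
def weightMinus (r n : ℕ) (ε : ℝ) (ubar : ℤ → ℝ) (j : ℤ) (s : ℕ) : ℝ :=
  weightM r ε (fun k => ubar (j + k)) n s

/-- The left-biased WENO-M reconstruction at the right interface of the cell `0` of `v`. -/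
def recon (r n : ℕ) (ε : ℝ) (v : ℤ → ℝ) : ℝ :=
  ∑ s ∈ Finset.range r, weightM r ε v n s * subRecon r s v

/-- `u^-_{j+1/2}`. -/
def uMinus (r n : ℕ) (ε : ℝ) (ubar : ℤ → ℝ) (j : ℤ) : ℝ :=
  recon r n ε (fun k => ubar (j + k))

/-- `u^+_{j+1/2}`, the mirror image of the left-biased reconstruction about `x_{j+1/2}`. -/
def uPlus (r n : ℕ) (ε : ℝ) (ubar : ℤ → ℝ) (j : ℤ) : ℝ :=
  recon r n ε (fun k => ubar (j + 1 - k))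

/-- The Lax–Friedrichs flux with viscosity constant `a`. -/
def laxFriedrichs (f : ℝ → ℝ) (a p q : ℝ) : ℝ :=
  (1 / 2) * (f p + f q - a * (q - p))

/-- The numerical flux at `x_{j+1/2}`. -/
def numFlux (r n : ℕ) (ε : ℝ) (f : ℝ → ℝ) (a : ℝ) (ubar : ℤ → ℝ) (j : ℤ) : ℝ :=
  laxFriedrichs f a (uMinus r n ε ubar j) (uPlus r n ε ubar j)

/-- The semi-discrete finite volume operator
`𝓛(u)_j = -(1/Δx) (f̂_{j+1/2} - f̂_{j-1/2})` of the `(2r-1)`th-order WENO-M(n) scheme. -/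
def schemeOp (r n : ℕ) (ε : ℝ) (f : ℝ → ℝ) (a h : ℝ) (ubar : ℤ → ℝ) (j : ℤ) : ℝ :=
  -(1 / h) * (numFlux r n ε f a ubar j - numFlux r n ε f a ubar (j - 1))

/-- The exact rate of change `-(1/Δx) (f(u(x_{j+1/2})) - f(u(x_{j-1/2})))` of the cell average
on the cell with centre `x`, for the conservation law `u_t + f(u)_x = 0`. -/
def exactOp (f u : ℝ → ℝ) (h x : ℝ) : ℝ :=
  -(1 / h) * (f (u (x + h / 2)) - f (u (x - h / 2)))

/-- `u' = ⋯ = u^{(m)} = 0` and `u^{(m+1)} ≠ 0` at `x`; for `m = 0` this says `u' ≠ 0`. -/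
def IsCriticalPointOfOrder (u : ℝ → ℝ) (x : ℝ) (m : ℕ) : Prop :=
  (∀ k, 1 ≤ k → k ≤ m → iteratedDeriv k u x = 0) ∧ iteratedDeriv (m + 1) u x ≠ 0

/-- The rate of convergence `r_c` of the `(2r-1)`th-order WENO-M(n) scheme at a critical point of
order `m`. -/
def convRate (r n m : ℕ) : ℤ :=
  if (m : ℤ) ≤ ⌊((3 : ℝ) ^ n - 1) / 3 ^ n * (r : ℝ) - 1⌋ then 2 * (r : ℤ) - 1
  else (3 ^ n + 1) * ((r : ℤ) - 1) - 3 ^ n * (m : ℤ)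

end WENO

end

/-!
By Vandermonde's identity the substencil reconstructions, combined with the optimal weights `d_s`,
give the reconstruction on all `2 r - 1` cells. When the first `m` derivatives of `u` vanish at
`xc`, every `β_s` agrees with the smoothness indicator of the Taylor polynomial of `u`, which is
of exact order `Δx ^ (2 (m + 1))`, up to a relative error `O(Δx ^ (r - 1 - m))`; the unmapped
weights are therefore within `O(Δx ^ (r - 1 - m))` of the `d_s`, whatever `ε` is. As `g_s ω - d_s`
is a multiple of `(ω - d_s) ^ 3`, each mapping triples this exponent.

The deviations of the weights from the `d_s` sum to zero, so they only multiply the `O(Δx ^ r)`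
errors of the substencil values. The error of the linear reconstruction is
`C Δx ^ (2 r - 1) + O(Δx ^ (2 r))` with the same `C` at both interfaces of a cell: its leading part
cancels in the flux difference, which makes up for the division by `Δx`.
-/

open Filter Topology Asymptotics

namespace WENO

/-! ### Weighted differences and the optimal weights -/

section Lagrange

variable {F : Type*} [Field F]

lemma sum_choose_mul_sum_choose_mul (f : ℕ → F) (m n : ℕ) :
    ∑ i ∈ Finset.range (m + 1), (m.choose i : F) *
        ∑ j ∈ Finset.range (n + 1), (n.choose j : F) * f (i + j) =
      ∑ k ∈ Finset.range (m + n + 1), ((m + n).choose k : F) * f k := by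
  induction m generalizing f with
  | zero => simp
  | succ m ih =>
    rw [Finset.sum_choose_succ_mul fun i _ => ∑ j ∈ Finset.range (n + 1), (n.choose j : F) *
      f (i + j), ih, show m + 1 + n + 1 = m + n + 2 by ring, show m + 1 + n = m + n + 1 by ring,
      Finset.sum_choose_succ_mul fun i _ => f i, ← ih fun k => f (k + 1)]
    simp only [Nat.add_right_comm]

lemma eval_derivative_basis_of_ne {ι : Type*} [DecidableEq ι] {s : Finset ι} {x : ι → F}
    (hx : Set.InjOn x s) {i a : ι} (hi : i ∈ s) (ha : a ∈ s) (hia : i ≠ a) :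
    (derivative (Lagrange.basis s x i)).eval (x a) =
      Lagrange.nodalWeight s x i / Lagrange.nodalWeight s x a / (x a - x i) := by
  have h_dvd : Lagrange.basis s x i * (X - C (x i)) =
      C (Lagrange.nodalWeight s x i) * Lagrange.nodal s x := by
    rw [Lagrange.basis_eq_prod_sub_inv_mul_nodal_div hi, mul_assoc, mul_comm (_ / _),
      EuclideanDomain.mul_div_cancel' (X_sub_C_ne_zero _) (Lagrange.X_sub_C_dvd_nodal x hi)]
  have h_deriv := congrArg (fun P => (derivative P).eval (x a)) h_dvd
  simp only [derivative_mul, derivative_X_sub_C, derivative_C, eval_add, eval_mul, eval_sub, eval_X,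
    eval_C, mul_one, zero_mul, zero_add, Lagrange.eval_basis_of_ne hia ha,
    add_zero] at h_deriv
  rw [eq_div_iff (sub_ne_zero.2 fun h => hia (hx hi ha h.symm)), h_deriv,
    Lagrange.nodalWeight_eq_eval_derivative_nodal ha, div_inv_eq_mul]

/-- The difference quotient of `y` between the nodes `a` and `k`, with the sign of the
corresponding term in the formula `eval_derivative_interpolate_range` for the derivative of an
interpolant at one of its equispaced nodes; the junk value at `k = a` is `0`. -/
def alternatingSlope (y : ℕ → F) (a k : ℕ) : F :=
  (-1) ^ (a + k + 1) * (y k - y a) / ((k : F) - a)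

lemma alternatingSlope_add_left_sub (y : ℕ → F) (c : F) (s a k : ℕ) :
    alternatingSlope (fun i => y (s + i) - c) a k = alternatingSlope y (s + a) (s + k) := by
  have h_sign : (-1 : F) ^ (s + a + (s + k) + 1) = (-1) ^ (a + k + 1) := by
    rw [show s + a + (s + k) + 1 = 2 * s + (a + k + 1) by ring, pow_add, pow_mul]
    simp
  simp [alternatingSlope, h_sign]

variable [CharZero F]

lemma injOn_add_natCast (c : F) (S : Set ℕ) : Set.InjOn (fun i : ℕ => c + (i : F)) S :=
  fun i _ j _ h => by simpa using h

lemma nodalWeight_range_succ (c : F) {n i : ℕ} (hi : i ≤ n) :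
    Lagrange.nodalWeight (Finset.range (n + 1)) (fun j : ℕ => c + j) i =
      (-1) ^ (n - i) * n.choose i / n.factorial := by
  have h_prod : ∏ j ∈ (Finset.range (n + 1)).erase i, ((i : F) - j) =
      (-1) ^ (n - i) * (i.factorial * (n - i).factorial) := by
    induction n, hi using Nat.le_induction with
    | base =>
      rw [Finset.range_add_one, Finset.erase_insert Finset.notMem_range_self,
        ← Finset.prod_range_reflect, ← Finset.prod_range_add_one_eq_factorial]
      simp only [Nat.sub_self, pow_zero, Nat.factorial_zero, Nat.cast_one, mul_one, one_mul,
        Nat.cast_prod]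
      refine Finset.prod_congr rfl fun j hj => ?_
      rw [← Nat.cast_sub (by omega)]
      congr 1
      have := Finset.mem_range.1 hj
      omega
    | succ n hin ih =>
      rw [Finset.range_add_one, Finset.erase_insert_of_ne (by omega), Finset.prod_insert (by simp),
        ih, Nat.succ_sub hin, Nat.factorial_succ, pow_succ]
      push_cast [Nat.cast_sub hin]
      ring
  have h_sq : ((-1 : F) ^ (n - i)) * (-1) ^ (n - i) = 1 := by rw [← mul_pow]; simp
  have h_fact (k : ℕ) : (k.factorial : F) ≠ 0 := Nat.cast_ne_zero.2 k.factorial_ne_zero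
  have := h_fact n
  have := h_fact i
  have := h_fact (n - i)
  simp only [Lagrange.nodalWeight, add_sub_add_left_eq_sub, Finset.prod_inv_distrib, h_prod]
  rw [Nat.cast_choose F hi, inv_eq_of_mul_eq_one_right]
  field_simp
  linear_combination h_sq

lemma eval_derivative_interpolate_range (c : F) {n a : ℕ} (ha : a ≤ n) (y : ℕ → F) :
    (derivative (Lagrange.interpolate (Finset.range (n + 1)) (fun j : ℕ => c - a + j) y)).eval c =
      (n.choose a : F)⁻¹ *
        ∑ i ∈ Finset.range (n + 1), (n.choose i : F) * alternatingSlope y a i := by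
  have h_inj := injOn_add_natCast (c - a) (Finset.range (n + 1) : Set ℕ)
  have ha_mem : a ∈ Finset.range (n + 1) := Finset.mem_range_succ_iff.2 ha
  have h_shift : derivative (Lagrange.interpolate (Finset.range (n + 1))
      (fun j : ℕ => c - a + j) y) = derivative (Lagrange.interpolate (Finset.range (n + 1))
      (fun j : ℕ => c - a + j) (y - y a • 1)) := by
    rw [map_sub, map_smul, Lagrange.interpolate_one h_inj ⟨a, ha_mem⟩]
    simp
  rw [h_shift, Lagrange.interpolate_apply, derivative_sum, eval_finsetSum, Finset.mul_sum]
  refine Finset.sum_congr rfl fun i hi => ?_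
  rw [derivative_C_mul, eval_C_mul]
  rcases eq_or_ne i a with rfl | hia
  · simp [alternatingSlope]
  have hin : i ≤ n := Finset.mem_range_succ_iff.1 hi
  have h_basis := eval_derivative_basis_of_ne h_inj hi ha_mem hia
  rw [sub_add_cancel, nodalWeight_range_succ _ hin, nodalWeight_range_succ _ ha] at h_basis
  have h_sign {k : ℕ} (hk : k ≤ n) : (-1 : F) ^ (n - k) = (-1) ^ n * (-1) ^ k := by
    rw [← pow_add, show n + k = n - k + 2 * k by omega, pow_add, pow_mul]
    simp
  have h_sq (k : ℕ) : ((-1 : F) ^ k) ^ 2 = 1 := by rw [← pow_mul, mul_comm, pow_mul]; simp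
  have h_fact : (n.factorial : F) ≠ 0 := Nat.cast_ne_zero.2 n.factorial_ne_zero
  have h_choose : (n.choose a : F) ≠ 0 := Nat.cast_ne_zero.2 (Nat.choose_pos ha).ne'
  have h_sub : (i : F) - a ≠ 0 := sub_ne_zero.2 (Nat.cast_injective.ne hia)
  have h_sub' : (a : F) - i ≠ 0 := sub_ne_zero.2 (Nat.cast_injective.ne hia.symm)
  rw [h_basis, show c - (c - a + i) = a - i by ring, h_sign hin, h_sign ha, alternatingSlope]
  simp only [Pi.sub_apply, Pi.smul_apply, Pi.one_apply, smul_eq_mul, mul_one]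
  field_simp
  linear_combination (a - i) * (y i - y a) * n.choose i * (-1) ^ i * h_sq a

end Lagrange

section LinearReconstruction

variable {r : ℕ}

/-- The reconstruction with the optimal weights `d_s` in place of the nonlinear ones. -/
noncomputable def linRecon (r : ℕ) (v : ℤ → ℝ) : ℝ :=
  ∑ s ∈ Finset.range r, optWeight r s * subRecon r s v

lemma primitiveValue_eq_sub (s : ℕ) (v : ℤ → ℝ) (i : ℕ) :
    primitiveValue r s v i = primitiveValue r 0 v (s + i) - primitiveValue r 0 v s := by
  rw [primitiveValue, primitiveValue, primitiveValue, Finset.sum_range_add, add_sub_cancel_left]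
  refine Finset.sum_congr rfl fun k _ => congrArg v ?_
  push_cast
  ring

lemma subRecon_eq_sum_alternatingSlope {s : ℕ} (hs : s < r) (v : ℤ → ℝ) :
    subRecon r s v = (r.choose s : ℝ)⁻¹ * ∑ i ∈ Finset.range (r + 1),
      (r.choose i : ℝ) * alternatingSlope (primitiveValue r 0 v) r (s + i) := by
  have h_nodes : (fun i : ℕ => (s : ℝ) - r + 1 / 2 + i) =
      fun i : ℕ => 1 / 2 - ((r - s : ℕ) : ℝ) + i := by
    funext i
    rw [Nat.cast_sub hs.le]
    ring
  rw [subRecon, reconPoly, h_nodes, eval_derivative_interpolate_range _ (Nat.sub_le r s),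
    Nat.choose_symm hs.le]
  simp only [funext (primitiveValue_eq_sub s v),
    alternatingSlope_add_left_sub, Nat.add_sub_cancel' hs.le]

lemma linRecon_eq_eval_derivative_interpolate (hr : 1 ≤ r) (v : ℤ → ℝ) :
    linRecon r v = (derivative (Lagrange.interpolate (Finset.range (2 * r - 1 + 1))
      (fun i : ℕ => 1 / 2 - (r : ℝ) + i) (primitiveValue r 0 v))).eval (1 / 2) := by
  have h_term : ∀ s ∈ Finset.range (r - 1 + 1), optWeight r s * subRecon r s v =
      ((2 * r - 1).choose r : ℝ)⁻¹ * (((r - 1).choose s : ℝ) * ∑ i ∈ Finset.range (r + 1),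
        (r.choose i : ℝ) * alternatingSlope (primitiveValue r 0 v) r (s + i)) := by
    intro s hs
    have hsr : s < r := by have := Finset.mem_range.1 hs; omega
    have h_choose : (r.choose s : ℝ) ≠ 0 := Nat.cast_ne_zero.2 (Nat.choose_pos hsr.le).ne'
    rw [subRecon_eq_sum_alternatingSlope hsr, optWeight,
      Nat.choose_symm_of_eq_add (show 2 * r - 1 = r - 1 + r by omega)]
    field_simp
  have h_vandermonde := sum_choose_mul_sum_choose_mul
    (alternatingSlope (primitiveValue r 0 v) r) (r - 1) r
  rw [Nat.sub_add_cancel hr, show r - 1 + r = 2 * r - 1 by omega] at h_vandermonde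
  rw [Nat.sub_add_cancel hr] at h_term
  rw [linRecon, Finset.sum_congr rfl h_term,
    ← Finset.mul_sum, h_vandermonde,
    eval_derivative_interpolate_range _ (show r ≤ 2 * r - 1 by omega)]

end LinearReconstruction

/-! ### Averages of polynomials -/

/-- The averages of `P` over the cells `[k - 1/2, k + 1/2]` of the mesh of width one. -/
noncomputable def polyAvg (P : ℝ[X]) (k : ℤ) : ℝ :=
  ∫ y in ((k : ℝ) - 1 / 2)..((k : ℝ) + 1 / 2), P.eval y

lemma derivative_surjective {F : Type*} [Field F] [CharZero F] :
    Function.Surjective (derivative : F[X] → F[X]) := by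
  intro P
  induction P using Polynomial.induction_on' with
  | add P₁ P₂ h₁ h₂ =>
    obtain ⟨⟨Q₁, rfl⟩, Q₂, rfl⟩ := And.intro h₁ h₂
    exact ⟨Q₁ + Q₂, derivative_add⟩
  | monomial n a =>
    refine ⟨monomial (n + 1) (a / (n + 1)), ?_⟩
    rw [derivative_monomial, Nat.add_sub_cancel, Nat.cast_add_one,
      div_mul_cancel₀ a (Nat.cast_add_one_ne_zero n)]

lemma polyAvg_derivative (Q : ℝ[X]) (k : ℤ) :
    polyAvg (derivative Q) k = Q.eval ((k : ℝ) + 1 / 2) - Q.eval ((k : ℝ) - 1 / 2) :=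
  intervalIntegral.integral_eq_sub_of_hasDerivAt (fun y _ => Q.hasDerivAt y)
    ((derivative Q).continuous.intervalIntegrable _ _)

lemma primitiveValue_polyAvg_derivative (r s : ℕ) (Q : ℝ[X]) (i : ℕ) :
    primitiveValue r s (polyAvg (derivative Q)) i =
      Q.eval ((s : ℝ) - r + 1 / 2 + i) - Q.eval ((s : ℝ) - r + 1 / 2) := by
  have h_telescope := Finset.sum_range_sub (fun k : ℕ => Q.eval ((s : ℝ) - r + 1 / 2 + k)) i
  rw [Nat.cast_zero, add_zero] at h_telescope
  rw [← h_telescope, primitiveValue]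
  refine Finset.sum_congr rfl fun k _ => ?_
  rw [polyAvg_derivative]
  push_cast
  congr 2 <;> ring

lemma derivative_interpolate_eval_sub {n : ℕ} (c b : ℝ) {Q : ℝ[X]} (hQ : Q.natDegree ≤ n) :
    derivative (Lagrange.interpolate (Finset.range (n + 1)) (fun i : ℕ => c + i)
      (fun i => Q.eval (c + i) - b)) = derivative Q := by
  have h_deg : (Q - C b).degree < (Finset.range (n + 1)).card := by
    rw [Finset.card_range]
    exact (degree_le_of_natDegree_le (by simpa)).trans_lt (by exact_mod_cast n.lt_succ_self)
  have h_interp := Lagrange.eq_interpolate (injOn_add_natCast c _) h_deg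
  simp only [eval_sub, eval_C] at h_interp
  rw [← h_interp, derivative_sub, derivative_C, sub_zero]

lemma reconPoly_polyAvg {r : ℕ} (s : ℕ) {P : ℝ[X]} (hP : P.natDegree < r) :
    reconPoly r s (polyAvg P) = P := by
  obtain ⟨Q, rfl⟩ := derivative_surjective P
  rw [natDegree_derivative] at hP
  rw [reconPoly, funext (primitiveValue_polyAvg_derivative r s Q),
    derivative_interpolate_eval_sub _ _ (by omega)]

lemma linRecon_polyAvg {r : ℕ} {P : ℝ[X]} (hP : P.natDegree + 1 < 2 * r) :
    linRecon r (polyAvg P) = P.eval (1 / 2) := by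
  obtain ⟨Q, rfl⟩ := derivative_surjective P
  rw [natDegree_derivative] at hP
  have h_prim : primitiveValue r 0 (polyAvg (derivative Q)) =
      fun i : ℕ => Q.eval (1 / 2 - (r : ℝ) + i) - Q.eval (1 / 2 - (r : ℝ)) := by
    funext i
    rw [primitiveValue_polyAvg_derivative, Nat.cast_zero, zero_sub, neg_add_eq_sub]
  rw [linRecon_eq_eval_derivative_interpolate (by omega), h_prim,
    derivative_interpolate_eval_sub _ _ (by omega)]

lemma sum_optWeight {r : ℕ} (hr : 1 ≤ r) : ∑ s ∈ Finset.range r, optWeight r s = 1 := by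
  have h_recon (s : ℕ) : reconPoly r s (polyAvg 1) = 1 :=
    reconPoly_polyAvg s (by rwa [natDegree_one])
  have h_exact := linRecon_polyAvg (r := r) (P := 1) (by rw [natDegree_one]; omega)
  simpa only [linRecon, subRecon, h_recon, eval_one, mul_one] using h_exact

/-! ### Positivity of the weights -/

/-- `w 0, …, w (r - 1)` are the coefficients of a convex combination, all of them positive. -/
def IsPositiveWeights (r : ℕ) (w : ℕ → ℝ) : Prop :=
  (∀ s < r, 0 < w s) ∧ ∑ s ∈ Finset.range r, w s = 1

section PositiveWeights

variable {r : ℕ}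

lemma IsPositiveWeights.lt_one {w : ℕ → ℝ} (hw : IsPositiveWeights r w) (hr : 2 ≤ r) {s : ℕ}
    (hs : s < r) : w s < 1 := by
  obtain ⟨t, ht, hts⟩ : ∃ t < r, t ≠ s := by
    rcases Nat.eq_zero_or_pos s with h | h
    · exact ⟨1, by omega, by omega⟩
    · exact ⟨0, by omega, by omega⟩
  rw [← hw.2]
  exact Finset.single_lt_sum hts (Finset.mem_range.2 hs) (Finset.mem_range.2 ht) (hw.1 t ht)
    fun k hk _ => (hw.1 k (Finset.mem_range.1 hk)).le

lemma isPositiveWeights_normalize (hr : r ≠ 0) {a : ℕ → ℝ} (ha : ∀ s < r, 0 < a s) :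
    IsPositiveWeights r fun s => a s / ∑ l ∈ Finset.range r, a l := by
  have h_sum : 0 < ∑ l ∈ Finset.range r, a l :=
    Finset.sum_pos (fun l hl => ha l (Finset.mem_range.1 hl)) (Finset.nonempty_range_iff.2 hr)
  refine ⟨fun s hs => div_pos (ha s hs) h_sum, ?_⟩
  rw [← Finset.sum_div, div_self h_sum.ne']

lemma isPositiveWeights_optWeight (hr : 1 ≤ r) : IsPositiveWeights r (optWeight r) := by
  refine ⟨fun s hs => ?_, sum_optWeight hr⟩
  have := Nat.choose_pos hs.le
  have := Nat.choose_pos (show s ≤ r - 1 by omega)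
  have := Nat.choose_pos (show r - 1 ≤ 2 * r - 1 by omega)
  unfold optWeight
  positivity

/-- The smoothness indicator of an arbitrary polynomial in the cell variable; `smoothness r s v` is
its value at `reconPoly r s v`. -/
noncomputable def polySmoothness (r : ℕ) (P : ℝ[X]) : ℝ :=
  ∑ i ∈ Finset.Icc 1 (r - 1), ∫ y in (-(1 / 2) : ℝ)..(1 / 2), ((derivative^[i] P).eval y) ^ 2

lemma integral_eval_sq_nonneg (P : ℝ[X]) :
    0 ≤ ∫ y in (-(1 / 2) : ℝ)..(1 / 2), (P.eval y) ^ 2 :=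
  intervalIntegral.integral_nonneg (by norm_num) fun _ _ => sq_nonneg _

lemma polySmoothness_nonneg (r : ℕ) (P : ℝ[X]) : 0 ≤ polySmoothness r P :=
  Finset.sum_nonneg fun _ _ => integral_eval_sq_nonneg _

lemma mapM_denom_pos {d w : ℝ} (hd : 0 < d) (hw0 : 0 ≤ w) (hw1 : w < 1) :
    0 < d ^ 2 + (1 - 2 * d) * w := by
  have h_convex : d ^ 2 + (1 - 2 * d) * w = (1 - w) * d ^ 2 + w * (1 - d) ^ 2 := by ring
  have := sub_pos.2 hw1
  rw [h_convex]
  positivity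

lemma mapM_pos {d w : ℝ} (hd : 0 < d) (hw0 : 0 < w) (hw1 : w < 1) : 0 < mapM d w := by
  have h_square : d + d ^ 2 - 3 * d * w + w ^ 2 = (w - d) ^ 2 + d * (1 - w) := by ring
  have := sub_pos.2 hw1
  have := mapM_denom_pos hd hw0.le hw1
  rw [mapM, h_square]
  positivity

lemma mapM_sub {d w : ℝ} (h : d ^ 2 + (1 - 2 * d) * w ≠ 0) :
    mapM d w - d = (w - d) ^ 3 / (d ^ 2 + (1 - 2 * d) * w) := by
  rw [mapM, div_sub' h]
  congr 1
  ring

lemma isPositiveWeights_weightM (hr : 2 ≤ r) {ε : ℝ} (hε : 0 < ε) (v : ℤ → ℝ) (n : ℕ) :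
    IsPositiveWeights r (weightM r ε v n) := by
  have h_opt := isPositiveWeights_optWeight (one_le_two.trans hr)
  induction n with
  | zero =>
    refine isPositiveWeights_normalize (by omega) fun s hs => ?_
    have : 0 ≤ smoothness r s v := polySmoothness_nonneg r _
    exact div_pos (h_opt.1 s hs) (by positivity)
  | succ n ih =>
    exact isPositiveWeights_normalize (by omega) fun s hs =>
      mapM_pos (h_opt.1 s hs) (ih.1 s hs) (ih.lt_one hr hs)

end PositiveWeights

/-! ### Asymptotics of the weights -/

section WeightAsymptotics

variable {α : Type*} {l : Filter α} {g : α → ℝ} {r : ℕ}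

lemma isBigO_normalize_sub {d : ℕ → ℝ} {a : α → ℕ → ℝ}
    (hd : ∑ s ∈ Finset.range r, d s = 1) (hg : Tendsto g l (𝓝 0))
    (ha : ∀ s < r, (fun p => a p s - d s) =O[l] g) {s : ℕ} (hs : s < r) :
    (fun p => a p s / ∑ k ∈ Finset.range r, a p k - d s) =O[l] g := by
  have h_sum : (fun p => ∑ k ∈ Finset.range r, a p k - 1) =O[l] g := by
    simpa only [Finset.sum_sub_distrib, hd] using
      IsBigO.fun_sum fun k hk => ha k (Finset.mem_range.1 hk)
  have h_lim : Tendsto (fun p => ∑ k ∈ Finset.range r, a p k) l (𝓝 1) :=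
    tendsto_sub_nhds_zero_iff.1 (h_sum.trans_tendsto hg)
  have h_prod := ((ha s hs).sub (h_sum.const_mul_left (d s))).mul
    ((h_lim.inv₀ one_ne_zero).isBigO_one ℝ)
  refine h_prod.congr' ?_ (by simp only [mul_one, EventuallyEq.rfl])
  filter_upwards [h_lim.eventually_ne one_ne_zero] with p hp
  field_simp
  ring

lemma isBigO_inv_sq_sub_one {η : α → ℝ} (hη0 : Tendsto η l (𝓝 0)) :
    (fun p => 1 / (1 + η p) ^ 2 - 1) =O[l] η := by
  have h_lim : Tendsto (fun p => 1 + η p) l (𝓝 1) := by simpa using hη0.const_add 1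
  have h_factor : Tendsto (fun p => -(2 + η p) / (1 + η p) ^ 2) l (𝓝 (-(2 + 0) / 1 ^ 2)) :=
    (hη0.const_add 2).neg.div (h_lim.pow 2) (by norm_num)
  refine ((isBigO_refl η l).mul (h_factor.isBigO_one ℝ)).congr' ?_
    (by simp only [mul_one, EventuallyEq.rfl])
  filter_upwards [h_lim.eventually_ne one_ne_zero] with p hp
  field_simp
  ring

lemma weightJS_eq_normalize {ε B : ℝ} (hB : ε + B ≠ 0) (v : ℤ → ℝ) (s : ℕ) :
    weightJS r ε v s = optWeight r s / (1 + (smoothness r s v - B) / (ε + B)) ^ 2 /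
      ∑ k ∈ Finset.range r, optWeight r k / (1 + (smoothness r k v - B) / (ε + B)) ^ 2 := by
  have h_rescale (k : ℕ) : optWeight r k / (1 + (smoothness r k v - B) / (ε + B)) ^ 2 =
      (ε + B) ^ 2 * alphaJS r ε v k := by
    have h_quot : 1 + (smoothness r k v - B) / (ε + B) = (ε + smoothness r k v) / (ε + B) := by
      field_simp
      ring
    rw [h_quot, div_pow, div_div_eq_mul_div, alphaJS]
    ring
  simp only [h_rescale]
  rw [← Finset.mul_sum, mul_div_mul_left _ _ (pow_ne_zero 2 hB), weightJS]

lemma isBigO_weightJS_sub (hr : 1 ≤ r) {ε B : α → ℝ} {v : α → ℤ → ℝ}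
    (hε : ∀ᶠ p in l, 0 < ε p) (hB : ∀ᶠ p in l, 0 ≤ B p) (hg : Tendsto g l (𝓝 0))
    (h : ∀ s < r, (fun p => smoothness r s (v p) - B p) =O[l] fun p => g p * B p) {s : ℕ}
    (hs : s < r) :
    (fun p => weightJS r (ε p) (v p) s - optWeight r s) =O[l] g := by
  have h_rel : ∀ k < r,
      (fun p => (smoothness r k (v p) - B p) / (ε p + B p)) =O[l] g := by
    intro k hk
    obtain ⟨c, hc0, hc⟩ := (h k hk).exists_nonneg
    refine IsBigO.of_bound c ?_
    filter_upwards [hc.bound, hε, hB] with p hp hεp hBp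
    have h_pos : 0 < ε p + B p := by positivity
    rw [norm_div, Real.norm_of_nonneg h_pos.le, div_le_iff₀ h_pos]
    refine hp.trans ?_
    rw [norm_mul, Real.norm_of_nonneg hBp, ← mul_assoc]
    gcongr
    exact le_add_of_nonneg_left hεp.le
  have h_normalize := isBigO_normalize_sub
    (a := fun p k => optWeight r k / (1 + (smoothness r k (v p) - B p) / (ε p + B p)) ^ 2)
    (sum_optWeight hr) hg (fun k hk => ?_) hs
  · refine h_normalize.congr' ?_ EventuallyEq.rfl
    filter_upwards [hε, hB] with p hεp hBp
    rw [weightJS_eq_normalize (B := B p) (by positivity)]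
  · refine (((isBigO_inv_sq_sub_one ((h_rel k hk).trans_tendsto hg)).trans
      (h_rel k hk)).const_mul_left (optWeight r k)).congr_left fun p => ?_
    ring

lemma isBigO_mapM_sub {d : ℝ} (hd0 : 0 < d) (hd1 : d < 1) {w : α → ℝ} (hg : Tendsto g l (𝓝 0))
    (hw : (fun p => w p - d) =O[l] g) :
    (fun p => mapM d (w p) - d) =O[l] fun p => g p ^ 3 := by
  have h_denom : d ^ 2 + (1 - 2 * d) * d ≠ 0 := (mapM_denom_pos hd0 hd0.le hd1).ne'
  have h_lim : Tendsto (fun p => d ^ 2 + (1 - 2 * d) * w p) l (𝓝 (d ^ 2 + (1 - 2 * d) * d)) :=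
    ((tendsto_sub_nhds_zero_iff.1 (hw.trans_tendsto hg)).const_mul _).const_add _
  refine ((hw.pow 3).mul ((h_lim.inv₀ h_denom).isBigO_one ℝ)).congr' ?_
    (by simp only [mul_one, EventuallyEq.rfl])
  filter_upwards [h_lim.eventually_ne h_denom] with p hp
  rw [mapM_sub hp, div_eq_mul_inv]

lemma isBigO_weightM_sub (hr : 2 ≤ r) {ε : α → ℝ} {v : α → ℤ → ℝ} (hg : Tendsto g l (𝓝 0))
    (h : ∀ s < r, (fun p => weightJS r (ε p) (v p) s - optWeight r s) =O[l] g) (n : ℕ) :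
    ∀ s < r, (fun p => weightM r (ε p) (v p) n s - optWeight r s) =O[l]
      fun p => g p ^ 3 ^ n := by
  have h_opt := isPositiveWeights_optWeight (one_le_two.trans hr)
  have hg_pow (k : ℕ) : Tendsto (fun p => g p ^ 3 ^ k) l (𝓝 0) := by simpa using hg.pow (3 ^ k)
  induction n with
  | zero => simpa [weightM] using h
  | succ n ih =>
    refine fun s hs => isBigO_normalize_sub
      (a := fun p k => mapM (optWeight r k) (weightM r (ε p) (v p) n k)) h_opt.2
      (hg_pow (n + 1)) (fun k hk => ?_) hs
    simpa only [pow_succ, pow_mul] using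
      isBigO_mapM_sub (h_opt.1 k hk) (h_opt.lt_one hr hk) (hg_pow n) (ih k hk)

end WeightAsymptotics

/-! ### Linearity in the data -/

section Linearity

variable (r s : ℕ)

lemma isLinearMap_polyAvg : IsLinearMap ℝ polyAvg where
  map_add P Q := funext fun k => by
    simp only [polyAvg, eval_add, Pi.add_apply]
    exact intervalIntegral.integral_add (P.continuous.intervalIntegrable _ _)
      (Q.continuous.intervalIntegrable _ _)
  map_smul c P := funext fun k => by
    simp only [polyAvg, eval_smul, Pi.smul_apply, intervalIntegral.integral_smul]

lemma isLinearMap_primitiveValue : IsLinearMap ℝ (primitiveValue r s) where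
  map_add _ _ := funext fun _ => Finset.sum_add_distrib
  map_smul _ _ := funext fun _ => (Finset.mul_sum _ _ _).symm

lemma isLinearMap_reconPoly : IsLinearMap ℝ (reconPoly r s) :=
  (derivative ∘ₗ Lagrange.interpolate _ _ ∘ₗ (isLinearMap_primitiveValue r s).mk' _).isLinear

lemma isLinearMap_subRecon : IsLinearMap ℝ (subRecon r s) :=
  (leval (1 / 2 : ℝ) ∘ₗ (isLinearMap_reconPoly r s).mk' _).isLinear

lemma isLinearMap_linRecon : IsLinearMap ℝ (linRecon r) where
  map_add v w := by
    simp only [linRecon, (isLinearMap_subRecon r _).map_add, mul_add, Finset.sum_add_distrib]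
  map_smul c v := by
    simp only [linRecon, (isLinearMap_subRecon r _).map_smul, smul_eq_mul, Finset.mul_sum,
      mul_left_comm]

end Linearity

lemma linRecon_polyAvg_sub_eval {r : ℕ} (hr : 1 ≤ r) {P : ℝ[X]} (hP : P.natDegree ≤ 2 * r - 1) :
    linRecon r (polyAvg P) - P.eval (1 / 2) = P.coeff (2 * r - 1) *
      (linRecon r (polyAvg (X ^ (2 * r - 1))) - (1 / 2) ^ (2 * r - 1)) := by
  set N := 2 * r - 1
  set Q := P - P.coeff N • X ^ N with hQ
  have hQ_deg : Q.natDegree + 1 < 2 * r := by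
    have : Q.natDegree ≤ N - 1 := by
      refine natDegree_le_iff_coeff_eq_zero.2 fun k hk => ?_
      rcases eq_or_ne k N with rfl | hkN
      · simp [hQ]
      · simp [hQ, coeff_X_pow, hkN, coeff_eq_zero_of_natDegree_lt (show P.natDegree < k by omega)]
    omega
  have hP_eq : P = Q + P.coeff N • X ^ N := (sub_add_cancel _ _).symm
  have h_lin : linRecon r (polyAvg P) =
      Q.eval (1 / 2) + P.coeff N * linRecon r (polyAvg (X ^ N)) := by
    conv_lhs => rw [hP_eq]
    rw [isLinearMap_polyAvg.map_add, isLinearMap_polyAvg.map_smul,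
      (isLinearMap_linRecon r).map_add, (isLinearMap_linRecon r).map_smul,
      linRecon_polyAvg hQ_deg, smul_eq_mul]
  have h_eval : P.eval (1 / 2) = Q.eval (1 / 2) + P.coeff N * (1 / 2) ^ N := by
    conv_lhs => rw [hP_eq]
    rw [eval_add, eval_smul, eval_pow, eval_X, smul_eq_mul]
  rw [h_lin, h_eval]
  ring

/-! ### Shrinking cells -/

/-- A family of cells of width `h p > 0` and centre `x p` which, along the filter `l`, shrink to
the point `xc` while staying within a bounded number of widths of it. -/
structure ShrinkingCells {α : Type*} (l : Filter α) (h x : α → ℝ) (xc : ℝ) : Prop where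
  width : Tendsto h l (𝓝[>] 0)
  centre : (fun p => x p - xc) =O[l] h

section ShrinkingCells

variable {α : Type*} {l : Filter α} {h x g : α → ℝ} {a b xc : ℝ}

lemma isBigO_intervalIntegral {F : ℝ → α → ℝ} (hab : a ≤ b)
    (hF : (fun q : ℝ × α => F q.1 q.2) =O[𝓟 (Set.Icc a b) ×ˢ l] fun q => g q.2) :
    (fun p => ∫ y in a..b, F y p) =O[l] g := by
  simp only [intervalIntegral.integral_of_le hab]
  exact (hF.mono (prod_mono_left _ (principal_mono.2 Set.Ioc_subset_Icc_self)))
    |>.set_integral_isBigO measure_Ioc_lt_top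

lemma eventually_principal_prod {s : Set ℝ} {P : ℝ × α → Prop} :
    (∀ᶠ q in 𝓟 s ×ˢ l, P q) ↔ ∀ᶠ p in l, ∀ y ∈ s, P (y, p) := by
  rw [eventually_swap_iff, eventually_prod_principal_iff]
  rfl

lemma isBigO_comp_fst_Icc {φ : ℝ → ℝ} (hφ : Continuous φ) (a b : ℝ) (l : Filter α) :
    (fun q : ℝ × α => φ q.1) =O[𝓟 (Set.Icc a b) ×ˢ l] fun _ => (1 : ℝ) := by
  obtain ⟨C, hC⟩ := (isCompact_Icc (a := a) (b := b)).exists_bound_of_continuousOn hφ.continuousOn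
  refine IsBigO.of_bound C (eventually_principal_prod.2 (Eventually.of_forall fun _ y hy => ?_))
  simpa only [norm_one, mul_one] using hC y hy

namespace ShrinkingCells

lemma eventually_pos (hx : ShrinkingCells l h x xc) : ∀ᶠ p in l, 0 < h p :=
  hx.width.eventually self_mem_nhdsWithin

lemma tendsto_width (hx : ShrinkingCells l h x xc) : Tendsto h l (𝓝 0) :=
  hx.width.mono_right nhdsWithin_le_nhds

lemma tendsto_centre (hx : ShrinkingCells l h x xc) : Tendsto x l (𝓝 xc) :=
  tendsto_sub_nhds_zero_iff.1 (hx.centre.trans_tendsto hx.tendsto_width)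

lemma isBigO_pow (hx : ShrinkingCells l h x xc) {m n : ℕ} (hmn : m ≤ n) :
    (fun p => h p ^ n) =O[l] fun p => h p ^ m := by
  rcases hmn.eq_or_lt with rfl | hlt
  · exact isBigO_refl _ _
  · exact (isLittleO_pow_pow hlt).isBigO.comp_tendsto hx.tendsto_width

lemma shift (hx : ShrinkingCells l h x xc) (c : ℝ) :
    ShrinkingCells l h (fun p => x p + c * h p) xc where
  width := hx.width
  centre := (hx.centre.add (isBigO_const_mul_self c h l)).congr_left fun p => by ring

lemma reflect (hx : ShrinkingCells l h x xc) : ShrinkingCells l h (fun p => 2 * xc - x p) xc where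
  width := hx.width
  centre := hx.centre.neg_left.congr_left fun p => by ring

lemma prod_Icc (hx : ShrinkingCells l h x xc) (a b : ℝ) :
    ShrinkingCells (𝓟 (Set.Icc a b) ×ˢ l) (fun q => h q.2) (fun q => x q.2 + q.1 * h q.2) xc where
  width := hx.width.comp tendsto_snd
  centre := by
    have h_offset : (fun q : ℝ × α => q.1 * h q.2) =O[𝓟 (Set.Icc a b) ×ˢ l] fun q => h q.2 := by
      simpa only [one_mul, id_eq] using
        (isBigO_comp_fst_Icc continuous_id a b l).mul (isBigO_refl (fun q : ℝ × α => h q.2) _)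
    exact ((hx.centre.comp_tendsto tendsto_snd).add h_offset).congr_left fun q => by
      simp only [Function.comp_apply]; ring

lemma isBigO_eval (hx : ShrinkingCells l h x xc) {P : ℝ[X]} {m : ℕ} (hP : X ^ m ∣ P) :
    (fun p => P.eval (x p - xc)) =O[l] fun p => h p ^ m := by
  obtain ⟨Q, rfl⟩ := hP
  have hQ : (fun p => Q.eval (x p - xc)) =O[l] fun _ => (1 : ℝ) :=
    (Q.continuous.continuousAt.tendsto.comp (tendsto_sub_nhds_zero_iff.2 hx.tendsto_centre))
      |>.isBigO_one ℝ
  simpa only [eval_mul, eval_pow, eval_X, mul_one] using (hx.centre.pow m).mul hQ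

end ShrinkingCells

end ShrinkingCells

/-! ### Taylor polynomials on shrinking cells -/

section Taylor

/-- The Taylor polynomial of degree `N` of `u` at `xc`, in the variable `x - xc`. -/
noncomputable def taylorPoly (u : ℝ → ℝ) (xc : ℝ) (N : ℕ) : ℝ[X] :=
  ∑ k ∈ Finset.range (N + 1), C (iteratedDeriv k u xc / k.factorial) * X ^ k

/-- The same Taylor polynomial in the cell variable `y`, where the point of a cell of width `h` and
centre `x` is `x + y * h`. -/
noncomputable def cellTaylor (u : ℝ → ℝ) (xc : ℝ) (N : ℕ) (h x : ℝ) : ℝ[X] :=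
  (taylorPoly u xc N).comp (C h * X + C (x - xc))

lemma coeff_taylorPoly (u : ℝ → ℝ) (xc : ℝ) {N k : ℕ} (hk : k ≤ N) :
    (taylorPoly u xc N).coeff k = iteratedDeriv k u xc / k.factorial := by
  simp only [taylorPoly, finsetSum_coeff, coeff_C_mul, coeff_X_pow, mul_ite, mul_one, mul_zero,
    Finset.sum_ite_eq, Finset.mem_range, Nat.lt_succ_of_le hk, if_true]

lemma natDegree_taylorPoly_le (u : ℝ → ℝ) (xc : ℝ) (N : ℕ) : (taylorPoly u xc N).natDegree ≤ N :=
  natDegree_sum_le_of_forall_le _ _ fun _ hk =>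
    (natDegree_C_mul_X_pow_le _ _).trans (Nat.lt_succ_iff.1 (Finset.mem_range.1 hk))

lemma isBigO_sub_taylorPoly {u : ℝ → ℝ} {xc : ℝ} {N : ℕ} (hu : ContDiffAt ℝ (N + 1 : ℕ) u xc) :
    (fun x => u x - (taylorPoly u xc N).eval (x - xc)) =O[𝓝 xc] fun x => (x - xc) ^ (N + 1) := by
  obtain ⟨U, hU, hu_on⟩ := hu.contDiffOn (m := (N + 1 : ℕ)) le_rfl (by simp)
  obtain ⟨δ, hδ, h_ball⟩ := Metric.mem_nhds_iff.1 hU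
  have hxc : xc ∈ Metric.ball xc δ := Metric.mem_ball_self hδ
  have h_taylor := taylor_isLittleO (convex_ball xc δ) hxc (hu_on.mono h_ball)
  rw [Metric.isOpen_ball.nhdsWithin_eq hxc] at h_taylor
  have h_eval (x : ℝ) : taylorWithinEval u (N + 1) (Metric.ball xc δ) xc x =
      (taylorPoly u xc N).eval (x - xc) +
        iteratedDeriv (N + 1) u xc / (N + 1).factorial * (x - xc) ^ (N + 1) := by
    rw [taylor_within_apply, Finset.sum_range_succ, taylorPoly, eval_finsetSum]
    simp only [iteratedDerivWithin_of_isOpen Metric.isOpen_ball hxc, eval_mul, eval_C, eval_pow,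
      eval_X, smul_eq_mul]
    congr 1
    · exact Finset.sum_congr rfl fun k _ => by ring
    · ring
  refine (h_taylor.isBigO.add (isBigO_const_mul_self
    (iteratedDeriv (N + 1) u xc / (N + 1).factorial) _ _)).congr_left fun x => ?_
  rw [h_eval]
  ring

lemma iterate_derivative_comp_linear {F : Type*} [CommSemiring F] (P : F[X]) (a b : F) (i : ℕ) :
    derivative^[i] (P.comp (C a * X + C b)) =
      C (a ^ i) * (derivative^[i] P).comp (C a * X + C b) := by
  induction i with
  | zero => simp
  | succ i ih =>
    rw [Function.iterate_succ_apply', ih, derivative_C_mul, derivative_comp,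
      Function.iterate_succ_apply', derivative_add, derivative_C_mul, derivative_X, derivative_C,
      mul_one, add_zero, pow_succ, C_mul, mul_assoc]

lemma coeff_comp_linear {F : Type*} [CommSemiring F] {P : F[X]} {n : ℕ} (hP : P.natDegree ≤ n)
    (a b : F) : (P.comp (C a * X + C b)).coeff n = a ^ n * P.coeff n := by
  have h_comp : P.comp (C a * X + C b) = (taylor b P).comp (C a * X) := by
    rw [taylor_apply, comp_assoc, add_comp, X_comp, C_comp]
  rw [h_comp, comp_C_mul_X_coeff, mul_comm]
  rcases hP.eq_or_lt with rfl | hlt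
  · rw [coeff_taylor_natDegree, leadingCoeff]
  · rw [coeff_eq_zero_of_natDegree_lt hlt,
      coeff_eq_zero_of_natDegree_lt ((natDegree_taylor P b).trans_lt hlt)]

variable {u : ℝ → ℝ} {xc : ℝ} {N : ℕ}

lemma natDegree_cellTaylor_le (h x : ℝ) : (cellTaylor u xc N h x).natDegree ≤ N :=
  natDegree_comp_le.trans <| (Nat.mul_le_mul (natDegree_taylorPoly_le u xc N)
    natDegree_linear_le).trans_eq (mul_one N)

lemma coeff_cellTaylor (h x : ℝ) :
    (cellTaylor u xc N h x).coeff N = h ^ N * (taylorPoly u xc N).coeff N :=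
  coeff_comp_linear (natDegree_taylorPoly_le u xc N) _ _

lemma eval_iterate_derivative_cellTaylor (h x : ℝ) (i : ℕ) (y : ℝ) :
    (derivative^[i] (cellTaylor u xc N h x)).eval y =
      h ^ i * (derivative^[i] (taylorPoly u xc N)).eval (x + y * h - xc) := by
  rw [cellTaylor, iterate_derivative_comp_linear, eval_mul, eval_C, eval_comp]
  congr 2
  simp only [eval_add, eval_mul, eval_C, eval_X]
  ring

lemma eval_cellTaylor (h x y : ℝ) :
    (cellTaylor u xc N h x).eval y = (taylorPoly u xc N).eval (x + y * h - xc) := by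
  simpa using eval_iterate_derivative_cellTaylor h x 0 y

variable {α : Type*} {l : Filter α} {h x : α → ℝ}

lemma ShrinkingCells.isBigO_sub_eval_taylorPoly (hx : ShrinkingCells l h x xc)
    (hu : ContDiffAt ℝ (N + 1 : ℕ) u xc) :
    (fun p => u (x p) - (taylorPoly u xc N).eval (x p - xc)) =O[l] fun p => h p ^ (N + 1) :=
  ((isBigO_sub_taylorPoly hu).comp_tendsto hx.tendsto_centre).trans (hx.centre.pow (N + 1))

lemma ShrinkingCells.isBigO_sub_eval_cellTaylor (hx : ShrinkingCells l h x xc)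
    (hu : ContDiffAt ℝ (N + 1 : ℕ) u xc) (y : ℝ) :
    (fun p => u (x p + y * h p) - (cellTaylor u xc N (h p) (x p)).eval y) =O[l]
      fun p => h p ^ (N + 1) := by
  simpa only [eval_cellTaylor] using (hx.shift y).isBigO_sub_eval_taylorPoly hu

lemma meshAverages_eq_integral (u : ℝ → ℝ) {h : ℝ} (hh : h ≠ 0) (x : ℝ) (k : ℤ) :
    meshAverages u h x k = ∫ y in ((k : ℝ) - 1 / 2)..((k : ℝ) + 1 / 2), u (x + y * h) := by
  simp only [mul_comm _ h]
  rw [intervalIntegral.integral_comp_add_mul u hh, meshAverages, cellAverage, smul_eq_mul, one_div]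
  congr 2 <;> ring

lemma ShrinkingCells.isBigO_meshAverages_sub (hx : ShrinkingCells l h x xc)
    (hu : ContDiffAt ℝ (N + 1 : ℕ) u xc) (k : ℤ) :
    (fun p => meshAverages u (h p) (x p) k - polyAvg (cellTaylor u xc N (h p) (x p)) k) =O[l]
      fun p => h p ^ (N + 1) := by
  have hk : (k : ℝ) - 1 / 2 ≤ k + 1 / 2 := by linarith
  have hx_cell := hx.prod_Icc ((k : ℝ) - 1 / 2) (k + 1 / 2)
  have h_remainder : (fun p => ∫ y in ((k : ℝ) - 1 / 2)..((k : ℝ) + 1 / 2),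
      (u (x p + y * h p) - (cellTaylor u xc N (h p) (x p)).eval y)) =O[l]
        fun p => h p ^ (N + 1) :=
    isBigO_intervalIntegral hk <| by
      simp only [eval_cellTaylor]
      exact hx_cell.isBigO_sub_eval_taylorPoly hu
  have h_continuousAt : ∀ᶠ t in 𝓝 xc, ContinuousAt u t :=
    (hu.eventually (by simp)).mono fun _ ht => ht.continuousAt
  refine h_remainder.congr' ?_ EventuallyEq.rfl
  filter_upwards [hx.eventually_pos, eventually_principal_prod.1
    (hx_cell.tendsto_centre.eventually h_continuousAt)] with p hp h_cont
  rw [meshAverages_eq_integral u hp.ne', polyAvg]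
  refine intervalIntegral.integral_sub (ContinuousOn.intervalIntegrable fun y hy => ?_)
    ((cellTaylor u xc N (h p) (x p)).continuous.intervalIntegrable _ _)
  rw [Set.uIcc_of_le hk] at hy
  exact (ContinuousAt.comp (f := fun y => x p + y * h p) (h_cont y hy)
    (by fun_prop)).continuousWithinAt

end Taylor

/-! ### Stability of the reconstruction -/

section Stability

variable {α : Type*} {l : Filter α} {g G : α → ℝ} {w : α → ℤ → ℝ}

lemma isBigO_primitiveValue (hw : ∀ k, (fun p => w p k) =O[l] g) (r s i : ℕ) :
    (fun p => primitiveValue r s (w p) i) =O[l] g :=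
  IsBigO.fun_sum fun _ _ => hw _

lemma isBigO_iterate_derivative_reconPoly (hw : ∀ k, (fun p => w p k) =O[l] g) (r s i : ℕ)
    (a b : ℝ) :
    (fun q : ℝ × α => (derivative^[i] (reconPoly r s (w q.2))).eval q.1)
      =O[𝓟 (Set.Icc a b) ×ˢ l] fun q => g q.2 := by
  simp only [reconPoly, Lagrange.interpolate_apply, derivative_sum, derivative_C_mul,
    iterate_derivative_sum, iterate_derivative_C_mul, eval_finsetSum, eval_C_mul]
  refine IsBigO.fun_sum fun j _ => ?_
  simpa only [mul_one, Function.comp_apply] using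
    ((isBigO_primitiveValue hw r s j).comp_tendsto tendsto_snd).mul
      (isBigO_comp_fst_Icc (Polynomial.continuous _) a b l)

lemma isBigO_subRecon (hw : ∀ k, (fun p => w p k) =O[l] g) (r s : ℕ) :
    (fun p => subRecon r s (w p)) =O[l] g :=
  (isBigO_iterate_derivative_reconPoly hw r s 0 (1 / 2) (1 / 2)).comp_tendsto
    (k := fun p => (1 / 2, p)) ((tendsto_principal.2 (by simp)).prodMk tendsto_id)

lemma isBigO_linRecon (hw : ∀ k, (fun p => w p k) =O[l] g) (r : ℕ) :
    (fun p => linRecon r (w p)) =O[l] g :=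
  IsBigO.fun_sum fun s _ => (isBigO_subRecon hw r s).const_mul_left _

lemma isBigO_polySmoothness_add_sub {P W : α → ℝ[X]} (r : ℕ)
    (hP : ∀ i, 1 ≤ i → (fun q : ℝ × α => (derivative^[i] (P q.2)).eval q.1)
      =O[𝓟 (Set.Icc (-(1 / 2)) (1 / 2)) ×ˢ l] fun q => g q.2)
    (hW : ∀ i, (fun q : ℝ × α => (derivative^[i] (W q.2)).eval q.1)
      =O[𝓟 (Set.Icc (-(1 / 2)) (1 / 2)) ×ˢ l] fun q => G q.2)
    (hG : G =O[l] g) :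
    (fun p => polySmoothness r (P p + W p) - polySmoothness r (P p)) =O[l]
      fun p => g p * G p := by
  simp only [polySmoothness, ← Finset.sum_sub_distrib]
  refine IsBigO.fun_sum fun i hi => ?_
  have h_integral (p : α) :
      (∫ y in (-(1 / 2) : ℝ)..(1 / 2), ((derivative^[i] (P p + W p)).eval y) ^ 2) -
        ∫ y in (-(1 / 2) : ℝ)..(1 / 2), ((derivative^[i] (P p)).eval y) ^ 2 =
      ∫ y in (-(1 / 2) : ℝ)..(1 / 2), (2 * (derivative^[i] (P p)).eval y +
        (derivative^[i] (W p)).eval y) * (derivative^[i] (W p)).eval y := by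
    rw [← intervalIntegral.integral_sub (Continuous.intervalIntegrable (by fun_prop) _ _)
      (Continuous.intervalIntegrable (by fun_prop) _ _)]
    refine intervalIntegral.integral_congr fun y _ => ?_
    simp only [iterate_map_add, eval_add]
    ring
  simp only [h_integral]
  exact isBigO_intervalIntegral (by norm_num)
    ((((hP i (Finset.mem_Icc.1 hi).1).const_mul_left 2).add
      ((hW i).trans (hG.comp_tendsto tendsto_snd))).mul (hW i))

end Stability

/-! ### The weights near a critical point -/

section CriticalPoint

variable {α : Type*} {l : Filter α} {h x : α → ℝ} {u : ℝ → ℝ} {xc : ℝ} {r m N : ℕ}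

lemma X_pow_dvd_iterate_derivative_taylorPoly (hcp : IsCriticalPointOfOrder u xc m) (hN : m ≤ N)
    {i : ℕ} (hi : 1 ≤ i) : X ^ (m + 1 - i) ∣ derivative^[i] (taylorPoly u xc N) := by
  rw [X_pow_dvd_iff]
  intro k hk
  rw [coeff_iterate_derivative, coeff_taylorPoly u xc (by omega),
    hcp.1 _ (by omega) (by omega), zero_div, smul_zero]

lemma eval_zero_iterate_derivative_taylorPoly {k : ℕ} (hk : k ≤ N) :
    (derivative^[k] (taylorPoly u xc N)).eval 0 = iteratedDeriv k u xc := by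
  rw [← coeff_zero_eq_eval_zero, coeff_iterate_derivative, zero_add, coeff_taylorPoly u xc hk,
    Nat.descFactorial_self, nsmul_eq_mul, mul_div_cancel₀ _ (by positivity)]

lemma ShrinkingCells.isBigO_iterate_derivative_cellTaylor (hx : ShrinkingCells l h x xc)
    (hcp : IsCriticalPointOfOrder u xc m) (hN : m ≤ N) {i : ℕ} (hi : 1 ≤ i) (a b : ℝ) :
    (fun q : ℝ × α => (derivative^[i] (cellTaylor u xc N (h q.2) (x q.2))).eval q.1)
      =O[𝓟 (Set.Icc a b) ×ˢ l] fun q => h q.2 ^ (m + 1) := by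
  have hx_cell := hx.prod_Icc a b
  simp only [eval_iterate_derivative_cellTaylor]
  refine IsBigO.trans ?_ (hx_cell.isBigO_pow (show m + 1 ≤ i + (m + 1 - i) by omega))
  simp only [pow_add]
  exact (isBigO_refl _ _).mul
    (hx_cell.isBigO_eval (X_pow_dvd_iterate_derivative_taylorPoly hcp hN hi))

lemma ShrinkingCells.tendsto_integral_eval_sq (hx : ShrinkingCells l h x xc) (P : ℝ[X]) :
    Tendsto (fun p => ∫ y in (-(1 / 2) : ℝ)..(1 / 2), (P.eval (x p + y * h p - xc)) ^ 2) l
      (𝓝 (P.eval 0 ^ 2)) := by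
  have h_dvd : X ^ 1 ∣ P ^ 2 - C (P.eval 0 ^ 2) := by
    rw [pow_one, X_dvd_iff, coeff_zero_eq_eval_zero, eval_sub, eval_pow, eval_C, sub_self]
  have h_diff : (fun p => ∫ y in (-(1 / 2) : ℝ)..(1 / 2),
      (P ^ 2 - C (P.eval 0 ^ 2)).eval (x p + y * h p - xc)) =O[l] fun p => h p ^ 1 :=
    isBigO_intervalIntegral (by norm_num)
      ((hx.prod_Icc (-(1 / 2)) (1 / 2)).isBigO_eval h_dvd)
  refine tendsto_sub_nhds_zero_iff.1 ((h_diff.trans_tendsto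
    (by simpa using hx.tendsto_width)).congr fun p => ?_)
  simp only [eval_sub, eval_pow, eval_C]
  rw [intervalIntegral.integral_sub (Continuous.intervalIntegrable (by fun_prop) _ _)
    intervalIntegrable_const, intervalIntegral.integral_const]
  norm_num

lemma ShrinkingCells.isBigO_pow_polySmoothness (hx : ShrinkingCells l h x xc)
    (hcp : IsCriticalPointOfOrder u xc m) (hN : m + 1 ≤ N) (hr : m + 1 ≤ r - 1) :
    (fun p => h p ^ (2 * (m + 1))) =O[l]
      fun p => polySmoothness r (cellTaylor u xc N (h p) (x p)) := by
  set T := derivative^[m + 1] (taylorPoly u xc N) with hT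
  have hT0 : T.eval 0 ^ 2 ≠ 0 := by
    rw [hT, eval_zero_iterate_derivative_taylorPoly hN]
    exact pow_ne_zero 2 hcp.2
  have h_term (p : α) : (∫ y in (-(1 / 2) : ℝ)..(1 / 2),
      ((derivative^[m + 1] (cellTaylor u xc N (h p) (x p))).eval y) ^ 2) =
        h p ^ (2 * (m + 1)) *
          ∫ y in (-(1 / 2) : ℝ)..(1 / 2), (T.eval (x p + y * h p - xc)) ^ 2 := by
    simp only [eval_iterate_derivative_cellTaylor, ← hT, mul_pow,
      intervalIntegral.integral_const_mul, ← pow_mul, mul_comm (m + 1)]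
  have h_one : (fun _ => (1 : ℝ)) =O[l] fun p =>
      ∫ y in (-(1 / 2) : ℝ)..(1 / 2), (T.eval (x p + y * h p - xc)) ^ 2 :=
    (isBigO_const_const 1 hT0 l).trans
      ((isEquivalent_const_iff_tendsto hT0).2 (hx.tendsto_integral_eval_sq T)).isBigO_symm
  have h_mul := (isBigO_refl (fun p => h p ^ (2 * (m + 1))) l).mul h_one
  simp only [← h_term, mul_one] at h_mul
  refine h_mul.trans (IsBigO.of_bound' (Eventually.of_forall fun p => ?_))
  rw [Real.norm_of_nonneg (integral_eval_sq_nonneg _),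
    Real.norm_of_nonneg (polySmoothness_nonneg _ _)]
  exact Finset.single_le_sum (f := fun i => ∫ y in (-(1 / 2) : ℝ)..(1 / 2),
    ((derivative^[i] (cellTaylor u xc N (h p) (x p))).eval y) ^ 2)
      (fun _ _ => integral_eval_sq_nonneg _) (Finset.mem_Icc.2 ⟨Nat.le_add_left 1 m, hr⟩)

lemma ShrinkingCells.isBigO_smoothness_meshAverages_sub (hx : ShrinkingCells l h x xc)
    (hu : ContDiffAt ℝ (N + 1 : ℕ) u xc) (hcp : IsCriticalPointOfOrder u xc m) (hN : m ≤ N)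
    (s : ℕ) :
    (fun p => smoothness (N + 1) s (meshAverages u (h p) (x p)) -
      polySmoothness (N + 1) (cellTaylor u xc N (h p) (x p))) =O[l]
        fun p => h p ^ (m + 1) * h p ^ (N + 1) := by
  have h_split (p : α) : reconPoly (N + 1) s (meshAverages u (h p) (x p)) =
      cellTaylor u xc N (h p) (x p) + reconPoly (N + 1) s
        (meshAverages u (h p) (x p) - polyAvg (cellTaylor u xc N (h p) (x p))) := by
    rw [(isLinearMap_reconPoly _ s).map_sub,
      reconPoly_polyAvg s (Nat.lt_succ_of_le (natDegree_cellTaylor_le _ _)), add_sub_cancel]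
  refine (isBigO_polySmoothness_add_sub
    (P := fun p => cellTaylor u xc N (h p) (x p))
    (W := fun p => reconPoly (N + 1) s
      (meshAverages u (h p) (x p) - polyAvg (cellTaylor u xc N (h p) (x p)))) (N + 1)
    (fun _ hi => hx.isBigO_iterate_derivative_cellTaylor hcp hN hi _ _)
    (fun i => isBigO_iterate_derivative_reconPoly (hx.isBigO_meshAverages_sub hu) (N + 1) s i _ _)
    (hx.isBigO_pow (Nat.add_le_add_right hN 1))).congr_left fun p => ?_
  rw [← h_split]
  rfl

variable {ε : α → ℝ}

lemma ShrinkingCells.isBigO_weightJS_meshAverages_sub (hx : ShrinkingCells l h x xc)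
    (hε : ∀ᶠ p in l, 0 < ε p) (hu : ContDiffAt ℝ r u xc) (hcp : IsCriticalPointOfOrder u xc m)
    (hm : m + 1 < r) {s : ℕ} (hs : s < r) :
    (fun p => weightJS r (ε p) (meshAverages u (h p) (x p)) s - optWeight r s) =O[l]
      fun p => h p ^ (r - 1 - m) := by
  obtain ⟨N, rfl⟩ : ∃ N, r = N + 1 := ⟨r - 1, by omega⟩
  have h_tendsto : Tendsto (fun p => h p ^ (N + 1 - 1 - m)) l (𝓝 0) := by
    simpa [show N - m ≠ 0 by omega] using hx.tendsto_width.pow (N - m)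
  refine isBigO_weightJS_sub (by omega) hε
    (B := fun p => polySmoothness (N + 1) (cellTaylor u xc N (h p) (x p)))
    (Eventually.of_forall fun _ => polySmoothness_nonneg _ _) h_tendsto (fun k _ => ?_) hs
  refine (hx.isBigO_smoothness_meshAverages_sub hu hcp (by omega) k).trans ?_
  refine ((isBigO_refl (fun p => h p ^ (N + 1 - 1 - m)) l).mul
    (hx.isBigO_pow_polySmoothness (N := N) (r := N + 1) hcp (by omega) (by omega))).congr_left
      fun p => ?_
  rw [← pow_add, ← pow_add]
  congr 1
  omega

lemma ShrinkingCells.isBigO_weightM_meshAverages_sub (hx : ShrinkingCells l h x xc)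
    (hε : ∀ᶠ p in l, 0 < ε p) (hu : ContDiffAt ℝ r u xc) (hcp : IsCriticalPointOfOrder u xc m)
    (hr : 2 ≤ r) (hm : m ≤ r - 1) (n : ℕ) {s : ℕ} (hs : s < r) :
    (fun p => weightM r (ε p) (meshAverages u (h p) (x p)) n s - optWeight r s) =O[l]
      fun p => h p ^ (3 ^ n * (r - 1 - m)) := by
  rcases hm.eq_or_lt with rfl | hm
  · refine IsBigO.of_bound' (hε.mono fun p hp => ?_)
    have h_weight := isPositiveWeights_weightM hr hp (meshAverages u (h p) (x p)) n
    have h_opt := isPositiveWeights_optWeight (one_le_two.trans hr)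
    rw [Nat.sub_self, mul_zero, pow_zero, norm_one, Real.norm_eq_abs, abs_le]
    constructor <;>
      linarith [h_weight.1 s hs, h_weight.lt_one hr hs, h_opt.1 s hs, h_opt.lt_one hr hs]
  · simp only [mul_comm (3 ^ n), pow_mul]
    refine isBigO_weightM_sub hr ?_
      (fun k hk => hx.isBigO_weightJS_meshAverages_sub hε hu hcp (by omega) hk) n s hs
    simpa [show r - 1 - m ≠ 0 by omega] using hx.tendsto_width.pow (r - 1 - m)

end CriticalPoint

/-! ### The reconstruction error -/

section ReconstructionError

variable {α : Type*} {l : Filter α} {h x ε : α → ℝ} {u : ℝ → ℝ} {xc : ℝ} {r m : ℕ}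

lemma ShrinkingCells.isBigO_subRecon_meshAverages_sub (hx : ShrinkingCells l h x xc)
    (hu : ContDiffAt ℝ r u xc) (hr : 1 ≤ r) (s : ℕ) :
    (fun p => subRecon r s (meshAverages u (h p) (x p)) - u (x p + 1 / 2 * h p)) =O[l]
      fun p => h p ^ r := by
  obtain ⟨N, rfl⟩ : ∃ N, r = N + 1 := ⟨r - 1, by omega⟩
  refine ((isBigO_subRecon (hx.isBigO_meshAverages_sub hu) (N + 1) s).sub
    (hx.isBigO_sub_eval_cellTaylor hu (1 / 2))).congr_left fun p => ?_
  have h_exact : subRecon (N + 1) s (polyAvg (cellTaylor u xc N (h p) (x p))) =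
      (cellTaylor u xc N (h p) (x p)).eval (1 / 2) := by
    rw [subRecon, reconPoly_polyAvg s (Nat.lt_succ_of_le (natDegree_cellTaylor_le _ _))]
  refine (sub_left_inj.2 ((isLinearMap_subRecon (N + 1) s).map_sub _ _)).trans ?_
  rw [h_exact]
  ring

/-- The coefficient of `Δx ^ (2 * r - 1)` in the error of the linear reconstruction; it does not
depend on the position of the cell relative to `xc`. -/
noncomputable def linearErrorCoeff (r : ℕ) (u : ℝ → ℝ) (xc : ℝ) : ℝ :=
  (taylorPoly u xc (2 * r - 1)).coeff (2 * r - 1) *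
    (linRecon r (polyAvg (X ^ (2 * r - 1))) - (1 / 2) ^ (2 * r - 1))

lemma ShrinkingCells.isBigO_linRecon_meshAverages_sub (hx : ShrinkingCells l h x xc)
    (hu : ContDiffAt ℝ (2 * r : ℕ) u xc) (hr : 1 ≤ r) :
    (fun p => linRecon r (meshAverages u (h p) (x p)) - u (x p + 1 / 2 * h p) -
      linearErrorCoeff r u xc * h p ^ (2 * r - 1)) =O[l] fun p => h p ^ (2 * r) := by
  have h_order : 2 * r - 1 + 1 = 2 * r := by omega
  rw [← h_order] at hu
  have h_data := hx.isBigO_meshAverages_sub hu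
  have h_value := hx.isBigO_sub_eval_cellTaylor hu (1 / 2)
  simp only [h_order] at h_data h_value
  refine ((isBigO_linRecon h_data r).sub h_value).congr_left fun p => ?_
  have h_error := linRecon_polyAvg_sub_eval hr
    (natDegree_cellTaylor_le (u := u) (xc := xc) (N := 2 * r - 1) (h p) (x p))
  rw [coeff_cellTaylor] at h_error
  refine (sub_left_inj.2 ((isLinearMap_linRecon r).map_sub _ _)).trans ?_
  rw [linearErrorCoeff]
  linear_combination -h_error

lemma recon_sub_eq (hr : 2 ≤ r) {ε : ℝ} (hε : 0 < ε) (n : ℕ) (v : ℤ → ℝ) (c : ℝ) :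
    recon r n ε v - c = ∑ s ∈ Finset.range r, (weightM r ε v n s - optWeight r s) *
      (subRecon r s v - c) + (linRecon r v - c) := by
  simp only [sub_mul, mul_sub, Finset.sum_sub_distrib, ← Finset.sum_mul,
    (isPositiveWeights_weightM hr hε v n).2, sum_optWeight (one_le_two.trans hr), recon, linRecon]
  ring

lemma ShrinkingCells.isBigO_recon_meshAverages_sub (hx : ShrinkingCells l h x xc)
    (hε : ∀ᶠ p in l, 0 < ε p) (hu : ContDiffAt ℝ (2 * r : ℕ) u xc)
    (hcp : IsCriticalPointOfOrder u xc m) (hr : 2 ≤ r) (hm : m ≤ r - 1) (n : ℕ) :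
    (fun p => recon r n (ε p) (meshAverages u (h p) (x p)) - u (x p + 1 / 2 * h p) -
      linearErrorCoeff r u xc * h p ^ (2 * r - 1)) =O[l]
        fun p => h p ^ min (2 * r) (r + 3 ^ n * (r - 1 - m)) := by
  have hu_r : ContDiffAt ℝ r u xc := hu.of_le (by exact_mod_cast (by omega : r ≤ 2 * r))
  have h_nonlinear : (fun p => ∑ s ∈ Finset.range r,
      (weightM r (ε p) (meshAverages u (h p) (x p)) n s - optWeight r s) *
        (subRecon r s (meshAverages u (h p) (x p)) - u (x p + 1 / 2 * h p))) =O[l]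
      fun p => h p ^ (r + 3 ^ n * (r - 1 - m)) := by
    simp only [pow_add, mul_comm (h _ ^ r)]
    exact IsBigO.fun_sum fun s hs =>
      (hx.isBigO_weightM_meshAverages_sub hε hu_r hcp hr hm n (Finset.mem_range.1 hs)).mul
        (hx.isBigO_subRecon_meshAverages_sub hu_r (one_le_two.trans hr) s)
  refine ((h_nonlinear.trans (hx.isBigO_pow (min_le_right _ _))).add
    ((hx.isBigO_linRecon_meshAverages_sub hu (one_le_two.trans hr)).trans
      (hx.isBigO_pow (min_le_left _ _)))).congr' (hε.mono fun p hp => ?_) EventuallyEq.rfl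
  simp only [recon_sub_eq hr hp, add_sub_assoc]

end ReconstructionError

/-! ### Mirror images and the interface values -/

lemma cellAverage_reflect (u : ℝ → ℝ) (xc h y : ℝ) :
    cellAverage (fun x => u (2 * xc - x)) h y = cellAverage u h (2 * xc - y) := by
  rw [cellAverage, cellAverage, intervalIntegral.integral_comp_sub_left u (2 * xc)]
  congr 2 <;> ring

lemma meshAverages_add_index (u : ℝ → ℝ) (h x₀ : ℝ) (j : ℤ) :
    (fun k => meshAverages u h x₀ (j + k)) = meshAverages u h (x₀ + j * h) := by
  funext k
  simp only [meshAverages, Int.cast_add, add_mul, add_assoc]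

lemma meshAverages_sub_index (u : ℝ → ℝ) (xc h x₀ : ℝ) (j : ℤ) :
    (fun k => meshAverages u h x₀ (j - k)) =
      meshAverages (fun x => u (2 * xc - x)) h (2 * xc - (x₀ + j * h)) := by
  funext k
  rw [meshAverages, meshAverages, cellAverage_reflect]
  push_cast
  ring_nf

lemma IsCriticalPointOfOrder.reflect {u : ℝ → ℝ} {xc : ℝ} {m : ℕ}
    (hcp : IsCriticalPointOfOrder u xc m) :
    IsCriticalPointOfOrder (fun x => u (2 * xc - x)) xc m := by
  have h_deriv (k : ℕ) :
      iteratedDeriv k (fun x => u (2 * xc - x)) xc = (-1) ^ k * iteratedDeriv k u xc := by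
    simp only [iteratedDeriv_comp_const_sub, smul_eq_mul, two_mul, add_sub_cancel_right]
  refine ⟨fun k hk hkm => by rw [h_deriv, hcp.1 k hk hkm, mul_zero], ?_⟩
  rw [h_deriv]
  exact mul_ne_zero (pow_ne_zero _ (neg_ne_zero.2 one_ne_zero)) hcp.2

lemma contDiffAt_reflect {u : ℝ → ℝ} {xc : ℝ} {N : ℕ∞ω} (hu : ContDiffAt ℝ N u xc) :
    ContDiffAt ℝ N (fun x => u (2 * xc - x)) xc := by
  refine ContDiffAt.comp (g := u) (f := fun x => 2 * xc - x) xc ?_ (by fun_prop)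
  rwa [two_mul, add_sub_cancel_right]

section Interface

variable {α : Type*} {l : Filter α} {h ε x₀ : α → ℝ} {j : α → ℤ} {u : ℝ → ℝ} {xc : ℝ} {r m : ℕ}

lemma ShrinkingCells.add_index (hx : ShrinkingCells l h (fun p => x₀ p + j p * h p) xc) (i : ℤ) :
    ShrinkingCells l h (fun p => x₀ p + (j p + i : ℤ) * h p) xc := by
  simpa only [Int.cast_add, add_mul, add_assoc] using hx.shift i

lemma ShrinkingCells.isBigO_uMinus_sub
    (hx : ShrinkingCells l h (fun p => x₀ p + j p * h p) xc) (hε : ∀ᶠ p in l, 0 < ε p)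
    (hu : ContDiffAt ℝ (2 * r : ℕ) u xc) (hcp : IsCriticalPointOfOrder u xc m) (hr : 2 ≤ r)
    (hm : m ≤ r - 1) (n : ℕ) :
    (fun p => uMinus r n (ε p) (meshAverages u (h p) (x₀ p)) (j p) -
      u (x₀ p + j p * h p + 1 / 2 * h p) - linearErrorCoeff r u xc * h p ^ (2 * r - 1)) =O[l]
        fun p => h p ^ min (2 * r) (r + 3 ^ n * (r - 1 - m)) := by
  simp only [uMinus, meshAverages_add_index]
  exact hx.isBigO_recon_meshAverages_sub hε hu hcp hr hm n

lemma ShrinkingCells.isBigO_uPlus_sub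
    (hx : ShrinkingCells l h (fun p => x₀ p + j p * h p) xc) (hε : ∀ᶠ p in l, 0 < ε p)
    (hu : ContDiffAt ℝ (2 * r : ℕ) u xc) (hcp : IsCriticalPointOfOrder u xc m) (hr : 2 ≤ r)
    (hm : m ≤ r - 1) (n : ℕ) :
    (fun p => uPlus r n (ε p) (meshAverages u (h p) (x₀ p)) (j p) -
      u (x₀ p + j p * h p + 1 / 2 * h p) -
        linearErrorCoeff r (fun x => u (2 * xc - x)) xc * h p ^ (2 * r - 1)) =O[l]
          fun p => h p ^ min (2 * r) (r + 3 ^ n * (r - 1 - m)) := by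
  have h_interface (p : α) : 2 * xc - (2 * xc - (x₀ p + (j p + 1 : ℤ) * h p) + 1 / 2 * h p) =
      x₀ p + j p * h p + 1 / 2 * h p := by
    push_cast
    ring
  simpa only [uPlus, meshAverages_sub_index u xc, h_interface] using
    (hx.add_index 1).reflect.isBigO_recon_meshAverages_sub hε (contDiffAt_reflect hu)
      hcp.reflect hr hm n

end Interface

/-! ### Flux differences -/

section FluxDifference

variable {α : Type*} {l : Filter α}

lemma isBigO_comp_sub_comp {E F : Type*} [NormedAddCommGroup E] [NormedSpace ℝ E]
    [NormedAddCommGroup F] [NormedSpace ℝ F] {f : E → F} {c : E} {n : ℕ∞ω}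
    (hf : ContDiffAt ℝ n f c) (hn : n ≠ 0) {a b : α → E} (ha : Tendsto a l (𝓝 c))
    (hb : Tendsto b l (𝓝 c)) : (fun p => f (a p) - f (b p)) =O[l] fun p => a p - b p :=
  (hf.hasStrictFDerivAt hn).isBigO_sub.comp_tendsto (ha.prodMk_nhds hb)

lemma ShrinkingCells.isBigO_sub_of_shift {h x : α → ℝ} {u : ℝ → ℝ}
    {xc : ℝ} (hx : ShrinkingCells l h x xc) {N : ℕ∞ω} (hu : ContDiffAt ℝ N u xc) (hN : N ≠ 0)
    (c d : ℝ) : (fun p => u (x p + c * h p) - u (x p + d * h p)) =O[l] h :=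
  (isBigO_comp_sub_comp hu hN (hx.shift c).tendsto_centre (hx.shift d).tendsto_centre).trans
    ((isBigO_const_mul_self (c - d) h l).congr_left fun p => by ring)

lemma isBigO_second_difference {E F : Type*} [NormedAddCommGroup E] [NormedSpace ℝ E]
    [NormedAddCommGroup F] [NormedSpace ℝ F] {f : E → F} {c : E} (hf : ContDiffAt ℝ 2 f c)
    {a b e : α → E} (ha : Tendsto a l (𝓝 c)) (hb : Tendsto b l (𝓝 c)) (he : Tendsto e l (𝓝 0)) :
    (fun p => (f (a p + e p) - f (a p)) - (f (b p + e p) - f (b p))) =O[l]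
      fun p => ‖e p‖ * ‖a p - b p‖ := by
  obtain ⟨f', ⟨S, hS, hf'⟩, hf'_smooth⟩ := contDiffAt_succ_iff_hasFDerivAt.1
    (show ContDiffAt ℝ ((1 : ℕ) + 1) f c by simpa [one_add_one_eq_two] using hf)
  obtain ⟨L, T, hT, hL⟩ := hf'_smooth.exists_lipschitzOnWith
  obtain ⟨δ, hδ, h_ball⟩ := Metric.mem_nhds_iff.1 (inter_mem hS hT)
  have h_near {y : α → E} {z : E} (hy : Tendsto y l (𝓝 z)) :
      ∀ᶠ p in l, y p ∈ Metric.ball z (δ / 2) :=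
    hy.eventually (Metric.ball_mem_nhds z (half_pos hδ))
  refine IsBigO.of_bound L ?_
  filter_upwards [h_near ha, h_near hb, h_near he] with p hap hbp hep
  have h_mem {t : E} (ht : t ∈ Metric.ball c (δ / 2)) : t ∈ S ∩ T ∧ t + e p ∈ S ∩ T := by
    refine ⟨h_ball (Metric.ball_subset_ball (half_le_self hδ.le) ht), h_ball ?_⟩
    simpa only [ball_add_ball (half_pos hδ) (half_pos hδ), add_zero, add_halves] using
      Set.add_mem_add ht hep
  have h_deriv (t : E) (ht : t ∈ Metric.ball c (δ / 2)) :
      HasFDerivWithinAt (fun t => f (t + e p) - f t) (f' (t + e p) - f' t)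
        (Metric.ball c (δ / 2)) t :=
    (((hasFDerivAt_comp_add_right (e p)).2 (hf' _ (h_mem ht).2.1)).sub
      (hf' _ (h_mem ht).1.1)).hasFDerivWithinAt
  have h_bound (t : E) (ht : t ∈ Metric.ball c (δ / 2)) : ‖f' (t + e p) - f' t‖ ≤ L * ‖e p‖ := by
    simpa only [dist_eq_norm, add_sub_cancel_left] using
      hL.dist_le_mul _ (h_mem ht).2.2 _ (h_mem ht).1.2
  simpa only [norm_mul, norm_norm, mul_assoc] using
    (convex_ball c (δ / 2)).norm_image_sub_le_of_norm_hasFDerivWithin_le h_deriv h_bound hbp hap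

lemma isBigO_perturbed_difference {f : ℝ → ℝ} {c : ℝ} (hf : ContDiffAt ℝ 2 f c)
    {a b a' b' e H : α → ℝ} (ha : Tendsto a l (𝓝 c)) (hb : Tendsto b l (𝓝 c))
    (he : Tendsto e l (𝓝 0)) (hH : Tendsto H l (𝓝 0))
    (ha' : (fun p => a' p - a p - e p) =O[l] H) (hb' : (fun p => b' p - b p - e p) =O[l] H)
    (hab : (fun p => e p * (a p - b p)) =O[l] H) :
    (fun p => (f (a' p) - f (b' p)) - (f (a p) - f (b p))) =O[l] H := by
  have h_perturbed {y y' : α → ℝ} (hy : Tendsto y l (𝓝 c))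
      (hy' : (fun p => y' p - y p - e p) =O[l] H) :
      (fun p => f (y' p) - f (y p + e p)) =O[l] H := by
    have hy_add : Tendsto (fun p => y p + e p) l (𝓝 c) := by simpa using hy.add he
    have hy'_lim : Tendsto y' l (𝓝 c) := by simpa using (hy'.trans_tendsto hH).add hy_add
    simpa only [sub_sub] using
      (isBigO_comp_sub_comp hf two_ne_zero hy'_lim hy_add).trans
        (hy'.congr_left fun p => sub_sub _ _ _)
  have h_second := (isBigO_second_difference hf ha hb he).trans
    (hab.norm_left.congr_left fun p => norm_mul _ _)
  exact (((h_perturbed ha ha').sub (h_perturbed hb hb')).add h_second).congr_left fun p => by ring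

lemma isBigO_laxFriedrichs_difference {f : ℝ → ℝ} {c : ℝ} (hf : ContDiffAt ℝ 2 f c) (ν : ℝ)
    {a b a₁ b₁ a₂ b₂ e₁ e₂ H : α → ℝ} (ha : Tendsto a l (𝓝 c)) (hb : Tendsto b l (𝓝 c))
    (he₁ : Tendsto e₁ l (𝓝 0)) (he₂ : Tendsto e₂ l (𝓝 0)) (hH : Tendsto H l (𝓝 0))
    (ha₁ : (fun p => a₁ p - a p - e₁ p) =O[l] H) (hb₁ : (fun p => b₁ p - b p - e₁ p) =O[l] H)
    (ha₂ : (fun p => a₂ p - a p - e₂ p) =O[l] H) (hb₂ : (fun p => b₂ p - b p - e₂ p) =O[l] H)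
    (hab₁ : (fun p => e₁ p * (a p - b p)) =O[l] H)
    (hab₂ : (fun p => e₂ p * (a p - b p)) =O[l] H) :
    (fun p => (laxFriedrichs f ν (a₁ p) (a₂ p) - laxFriedrichs f ν (b₁ p) (b₂ p)) -
      (f (a p) - f (b p))) =O[l] H := by
  have h_viscosity := ((ha₂.sub hb₂).sub (ha₁.sub hb₁)).const_mul_left ν
  refine ((((isBigO_perturbed_difference hf ha hb he₁ hH ha₁ hb₁ hab₁).add
    (isBigO_perturbed_difference hf ha hb he₂ hH ha₂ hb₂ hab₂)).sub
      h_viscosity).const_mul_left (1 / 2)).congr_left fun p => ?_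
  simp only [laxFriedrichs]
  ring

end FluxDifference

/-! ### The scheme -/

lemma convRate_add_one {r n m : ℕ} (hm : m < r) :
    convRate r n m + 1 = (min (2 * r) (r + 3 ^ n * (r - 1 - m)) : ℕ) := by
  obtain ⟨q, rfl⟩ : ∃ q, r = m + 1 + q := ⟨r - 1 - m, by omega⟩
  have h_floor : (m : ℤ) ≤ ⌊((3 : ℝ) ^ n - 1) / 3 ^ n * ((m + 1 + q : ℕ) : ℝ) - 1⌋ ↔
      m + 1 + q ≤ 3 ^ n * q := by
    rw [Int.le_floor, div_mul_eq_mul_div, le_sub_iff_add_le, le_div_iff₀ (by positivity),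
      ← Nat.cast_le (α := ℝ)]
    push_cast
    constructor <;> intro h <;> linarith
  simp only [convRate, h_floor, show m + 1 + q - 1 - m = q by omega]
  split_ifs with h
  · rw [min_eq_left (by omega)]
    push_cast
    ring
  · rw [min_eq_right (by omega)]
    push_cast
    ring

section Scheme

variable {α : Type*} {l : Filter α} {h ε x₀ : α → ℝ} {j : α → ℤ} {u f : ℝ → ℝ} {xc : ℝ} {r m : ℕ}

lemma ShrinkingCells.isBigO_numFlux_sub
    (hx : ShrinkingCells l h (fun p => x₀ p + j p * h p) xc) (hε : ∀ᶠ p in l, 0 < ε p)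
    (hu : ContDiffAt ℝ (2 * r : ℕ) u xc) (hcp : IsCriticalPointOfOrder u xc m) (hr : 2 ≤ r)
    (hm : m ≤ r - 1) (n : ℕ) (hf : ContDiffAt ℝ 2 f (u xc)) (a : ℝ) :
    (fun p => (numFlux r n (ε p) f a (meshAverages u (h p) (x₀ p)) (j p) -
        numFlux r n (ε p) f a (meshAverages u (h p) (x₀ p)) (j p - 1)) -
      (f (u (x₀ p + j p * h p + 1 / 2 * h p)) - f (u (x₀ p + j p * h p + -(1 / 2) * h p))))
        =O[l] fun p => h p ^ min (2 * r) (r + 3 ^ n * (r - 1 - m)) := by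
  set q := min (2 * r) (r + 3 ^ n * (r - 1 - m))
  have h_pow_tendsto {k : ℕ} (hk : k ≠ 0) : Tendsto (fun p => h p ^ k) l (𝓝 0) := by
    simpa only [zero_pow hk] using hx.tendsto_width.pow k
  have h_value (c : ℝ) : Tendsto (fun p => u (x₀ p + j p * h p + c * h p)) l (𝓝 (u xc)) :=
    hu.continuousAt.tendsto.comp (hx.shift c).tendsto_centre
  have h_jump : (fun p => u (x₀ p + j p * h p + 1 / 2 * h p) -
      u (x₀ p + j p * h p + -(1 / 2) * h p)) =O[l] h :=
    hx.isBigO_sub_of_shift hu (by exact_mod_cast (by omega : 2 * r ≠ 0)) _ _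
  have h_leading (c : ℝ) : Tendsto (fun p => c * h p ^ (2 * r - 1)) l (𝓝 0) := by
    simpa only [mul_zero] using
      (h_pow_tendsto (k := 2 * r - 1) (by omega)).const_mul c
  have h_leading_jump (c : ℝ) : (fun p => c * h p ^ (2 * r - 1) *
      (u (x₀ p + j p * h p + 1 / 2 * h p) - u (x₀ p + j p * h p + -(1 / 2) * h p))) =O[l]
        fun p => h p ^ q := by
    refine (((isBigO_refl _ l).const_mul_left c).mul h_jump).trans ?_
    simpa only [← pow_succ, show 2 * r - 1 + 1 = 2 * r by omega] using
      hx.isBigO_pow (min_le_left _ _ : q ≤ 2 * r)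
  have h_left (p : α) : x₀ p + (j p - 1 : ℤ) * h p + 1 / 2 * h p =
      x₀ p + j p * h p + -(1 / 2) * h p := by
    push_cast
    ring
  have h_minus := (hx.add_index (-1)).isBigO_uMinus_sub hε hu hcp hr hm n
  have h_plus := (hx.add_index (-1)).isBigO_uPlus_sub hε hu hcp hr hm n
  simp only [h_left, ← sub_eq_add_neg (G := ℤ)] at h_minus h_plus
  exact isBigO_laxFriedrichs_difference hf a (h_value _) (h_value _) (h_leading _) (h_leading _)
    (h_pow_tendsto (by omega)) (hx.isBigO_uMinus_sub hε hu hcp hr hm n) h_minus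
    (hx.isBigO_uPlus_sub hε hu hcp hr hm n) h_plus (h_leading_jump _) (h_leading_jump _)

lemma ShrinkingCells.isBigO_schemeOp_sub_exactOp
    (hx : ShrinkingCells l h (fun p => x₀ p + j p * h p) xc) (hε : ∀ᶠ p in l, 0 < ε p)
    (hu : ContDiffAt ℝ (2 * r : ℕ) u xc) (hcp : IsCriticalPointOfOrder u xc m) (hr : 2 ≤ r)
    (hm : m ≤ r - 1) (n : ℕ) (hf : ContDiffAt ℝ 2 f (u xc)) (a : ℝ) :
    (fun p => schemeOp r n (ε p) f a (h p) (meshAverages u (h p) (x₀ p)) (j p) -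
      exactOp f u (h p) (x₀ p + j p * h p)) =O[l] fun p => h p ^ convRate r n m := by
  refine ((isBigO_refl (fun p => 1 / h p) l).mul
    (hx.isBigO_numFlux_sub hε hu hcp hr hm n hf a)).neg_left.congr'
      (Eventually.of_forall fun p => ?_) (hx.eventually_pos.mono fun p hp => ?_)
  · simp only [schemeOp, exactOp]
    ring_nf
  · dsimp only
    rw [← zpow_natCast, ← convRate_add_one (by omega), zpow_add_one₀ hp.ne']
    field_simp

end Scheme

/-! ### Uniform bounds -/

/-- The filter of mesh parameters `(Δx, ε, x₀, j)` with `Δx → 0⁺`, `ε > 0`, and the centre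
`x₀ + j * Δx` of the cell `j` within `K * Δx` of `xc`; a bound that holds eventually along it is
uniform in `ε`, `x₀` and `j`. -/
noncomputable def meshFilter (xc K : ℝ) : Filter (ℝ × ℝ × ℝ × ℤ) :=
  comap Prod.fst (𝓝[>] 0) ⊓
    𝓟 {p | 0 < p.2.1 ∧ |p.2.2.1 + p.2.2.2 * p.1 - xc| ≤ K * p.1}

lemma eventually_meshFilter {xc K : ℝ} {P : ℝ × ℝ × ℝ × ℤ → Prop} :
    (∀ᶠ p in meshFilter xc K, P p) ↔ ∃ h₀ > 0, ∀ h : ℝ, 0 < h → h < h₀ → ∀ ε : ℝ, 0 < ε →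
      ∀ (x₀ : ℝ) (j : ℤ), |x₀ + j * h - xc| ≤ K * h → P (h, ε, x₀, j) := by
  rw [meshFilter, eventually_inf_principal, eventually_comap, (nhdsGT_basis 0).eventually_iff]
  refine exists_congr fun h₀ => and_congr_right fun _ => ?_
  constructor
  · exact fun H h hh hh₀ ε hε x₀ j hx => H ⟨hh, hh₀⟩ (h, ε, x₀, j) rfl ⟨hε, hx⟩
  · rintro H _ hh ⟨h, ε, x₀, j⟩ rfl ⟨hε, hx⟩
    exact H h hh.1 hh.2 ε hε x₀ j hx

lemma shrinkingCells_meshFilter (xc K : ℝ) :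
    ShrinkingCells (meshFilter xc K) (fun p => p.1) (fun p => p.2.2.1 + p.2.2.2 * p.1) xc where
  width := tendsto_comap.mono_left inf_le_left
  centre := IsBigO.of_bound K (eventually_meshFilter.2 ⟨1, one_pos, fun h hh _ _ _ x₀ j hx => by
    rwa [Real.norm_eq_abs, Real.norm_of_nonneg hh.le]⟩)

lemma eventually_meshFilter_pos (xc K : ℝ) : ∀ᶠ p in meshFilter xc K, 0 < p.2.1 :=
  eventually_meshFilter.2 ⟨1, one_pos, fun _ _ _ _ hε _ _ _ => hε⟩

lemma exists_bound_of_isBigO_meshFilter {E : Type*} [SeminormedAddCommGroup E] {xc K : ℝ} {e : ℤ}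
    {F : ℝ × ℝ × ℝ × ℤ → E} (hF : F =O[meshFilter xc K] fun p => p.1 ^ e) :
    ∃ C > 0, ∃ h₀ > 0, ∀ h : ℝ, 0 < h → h < h₀ → ∀ ε : ℝ, 0 < ε →
      ∀ (x₀ : ℝ) (j : ℤ), |x₀ + j * h - xc| ≤ K * h → ‖F (h, ε, x₀, j)‖ ≤ C * h ^ e := by
  obtain ⟨C, hC, h_bound⟩ := hF.exists_pos
  obtain ⟨h₀, hh₀, H⟩ := eventually_meshFilter.1 h_bound.bound
  refine ⟨C, hC, h₀, hh₀, fun h hh hhh₀ ε hε x₀ j hx => ?_⟩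
  simpa only [Real.norm_of_nonneg (zpow_pos hh e).le] using H h hh hhh₀ ε hε x₀ j hx

lemma isBigO_weightMinus_meshFilter {u : ℝ → ℝ} {xc : ℝ} {r m : ℕ} (hu : ContDiffAt ℝ r u xc)
    (hcp : IsCriticalPointOfOrder u xc m) (hr : 2 ≤ r) (hm : m ≤ r - 1) (n : ℕ) (K : ℝ) :
    (fun p (s : Fin r) => weightMinus r n p.2.1 (meshAverages u p.1 p.2.2.1) p.2.2.2 s -
      optWeight r s) =O[meshFilter xc K] fun p => p.1 ^ (3 ^ n * ((r : ℤ) - 1 - m)) := by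
  have h_exponent : (3 : ℤ) ^ n * ((r : ℤ) - 1 - m) = (3 ^ n * (r - 1 - m) : ℕ) := by
    rw [Nat.cast_mul, Nat.sub_sub, Nat.cast_sub (by omega)]
    push_cast
    ring
  simp only [h_exponent, zpow_natCast, weightMinus, meshAverages_add_index]
  exact isBigO_pi.2 fun s => (shrinkingCells_meshFilter xc K).isBigO_weightM_meshAverages_sub
    (eventually_meshFilter_pos xc K) hu hcp hr hm n s.2

theorem mainTheorem3_general (r : ℕ) (hr : 2 ≤ r) (n ncp : ℕ) (hncp : ncp ≤ r - 1)
    (u : ℝ → ℝ) (xc : ℝ) (hu : ContDiffAt ℝ (2 * r : ℕ) u xc)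
    (hcp : IsCriticalPointOfOrder u xc ncp) (K : ℝ) :
    (∃ C > 0, ∃ h₀ > 0, ∀ h : ℝ, 0 < h → h < h₀ → ∀ ε : ℝ, 0 < ε →
      ∀ (x₀ : ℝ) (j : ℤ), |x₀ + j * h - xc| ≤ K * h → ∀ s < r,
        |weightMinus r n ε (meshAverages u h x₀) j s - optWeight r s|
          ≤ C * h ^ (3 ^ n * ((r : ℤ) - 1 - (ncp : ℤ)))) ∧
    (∀ (f : ℝ → ℝ) (a : ℝ), ContDiffAt ℝ 2 f (u xc) →
      ∃ C > 0, ∃ h₀ > 0, ∀ h : ℝ, 0 < h → h < h₀ → ∀ ε : ℝ, 0 < ε →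
      ∀ (x₀ : ℝ) (j : ℤ), |x₀ + j * h - xc| ≤ K * h →
        |schemeOp r n ε f a h (meshAverages u h x₀) j - exactOp f u h (x₀ + j * h)|
          ≤ C * h ^ convRate r n ncp) := by
  constructor
  · have hu_r : ContDiffAt ℝ r u xc := hu.of_le (by exact_mod_cast (by omega : r ≤ 2 * r))
    obtain ⟨C, hC, h₀, hh₀, h_bound⟩ := exists_bound_of_isBigO_meshFilter
      (isBigO_weightMinus_meshFilter hu_r hcp hr hncp n K)
    exact ⟨C, hC, h₀, hh₀, fun h hh hhh₀ ε hε x₀ j hx s hs =>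
      (norm_le_pi_norm _ (⟨s, hs⟩ : Fin r)).trans (h_bound h hh hhh₀ ε hε x₀ j hx)⟩
  · exact fun f a hf => exists_bound_of_isBigO_meshFilter
      ((shrinkingCells_meshFilter xc K).isBigO_schemeOp_sub_exactOp
        (eventually_meshFilter_pos xc K) hu hcp hr hncp n hf a)

end WENO

theorem mainTheorem3 (r : ℕ) (hr2 : 2 ≤ r) (hr9 : r ≤ 9) (n ncp : ℕ) (hncp : ncp ≤ r - 1)
    (u : ℝ → ℝ) (xc : ℝ) (hu : ContDiffAt ℝ ∞ u xc)
    (hcp : WENO.IsCriticalPointOfOrder u xc ncp) (K : ℝ) :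
    (∃ C > 0, ∃ h₀ > 0, ∀ h : ℝ, 0 < h → h < h₀ → ∀ ε : ℝ, 0 < ε →
      ∀ (x₀ : ℝ) (j : ℤ), |x₀ + j * h - xc| ≤ K * h → ∀ s < r,
        |WENO.weightMinus r n ε (WENO.meshAverages u h x₀) j s - WENO.optWeight r s|
          ≤ C * h ^ (3 ^ n * ((r : ℤ) - 1 - (ncp : ℤ)))) ∧
    (∀ (f : ℝ → ℝ) (a : ℝ), ContDiffAt ℝ ∞ f (u xc) →
      ∃ C > 0, ∃ h₀ > 0, ∀ h : ℝ, 0 < h → h < h₀ → ∀ ε : ℝ, 0 < ε →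
      ∀ (x₀ : ℝ) (j : ℤ), |x₀ + j * h - xc| ≤ K * h →
        |WENO.schemeOp r n ε f a h (WENO.meshAverages u h x₀) j
            - WENO.exactOp f u h (x₀ + j * h)|
          ≤ C * h ^ WENO.convRate r n ncp) := by
  obtain ⟨h_weights, h_scheme⟩ := WENO.mainTheorem3_general r hr2 n ncp hncp u xc
    (contDiffAt_infty.1 hu _) hcp K
  exact ⟨h_weights, fun f a hf => h_scheme f a (contDiffAt_infty.1 hf 2)⟩
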